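/- Let $N$ be a random variable with values in $\{0,1,2,\dots\}$ and let $Q, C$ be non-negative real random variables, with $P(Q>0)>0$. Index the potential individuals of a tree by the finite sequences $u=(i_1,\dots,i_n)$ of positive integers, $n\ge 0$, the empty sequence $\emptyset$ being the root. Let $\{N_u\}$, $\{Q_u\}$, $\{C_u\}$ be families of random variables, all mutually independent, such that each $N_u$, $Q_u$, $C_u$ is distributed as $N$, $Q$, $C$, respectively. Let $A_0=\{\emptyset\}$ and, for $n\ge 1$, $$A_n=\{(i_1,\dots,i_n): (i_1,\dots,i_{n-1})\in A_{n-1},\ 1\le i_n\le N_{(i_1,\dots,i_{n-1})}\},$$ and define $$W_n=\sum_{(i_1,\dots,i_n)\in A_n} Q_{(i_1,\dots,i_n)}\prod_{k=1}^n C_{(i_1,\dots,i_k)},\qquad R=\sum_{n=0}^\infty W_n\in[0,\infty].$$ Suppose that $P(N>x)=x^{-\alpha}L(x)$ for all $x>0$, where $\alpha>1$ and $L:[0,\infty)\to(0,\infty)$ is slowly varying, i.e. $L(\lambda x)/L(x)\to 1$ as $x\to\infty$ for every $\lambda>0$. Let $\rho=E[N]E[C]$ and $\rho_\alpha=E[N]E[C^\alpha]$.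 Assume that $\max\{\rho,\rho_\alpha\}<1$ and that $E[C^{\alpha+\epsilon}]<\infty$ and $E[Q^{\alpha+\epsilon}]<\infty$ for some $\epsilon>0$. Then $$\lim_{x\to\infty}\frac{P(R>x)}{P(N>x)}=\frac{(E[C]E[Q])^\alpha}{(1-\rho)^\alpha(1-\rho_\alpha)},$$ and if $P(C>0)>0$, so that this limit is positive, $$P(R>x)\sim\frac{(E[C]E[Q])^\alpha}{(1-\rho)^\alpha(1-\rho_\alpha)}\,P(N>x)\qquad (x\to\infty).$$ -/

import Mathlib

open MeasureTheory ProbabilityTheory Filter Topology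
open scoped NNReal ENNReal

/-- A function `L`, positive on `[0, ∞)`, is slowly varying (at infinity) if
`L (t * x) / L x → 1` as `x → ∞`, for every `t > 0`. -/
def SlowlyVarying (L : ℝ → ℝ) : Prop :=
  (∀ x, 0 ≤ x → 0 < L x) ∧
    ∀ t : ℝ, 0 < t → Tendsto (fun x => L (t * x) / L x) atTop (𝓝 1)

namespace WeightedBranching

/-- The families `N u`, `Q u`, `C u`, indexed by the potential individuals `u` (finite sequences of
natural numbers, the empty sequence being the root), consist of random variables distributed as the
generic variables `N₀`, `Q₀`, `C₀`, and all of these variables are mutually independent. -/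
structure IsInput {Ω : Type*} [MeasurableSpace Ω] (μ : Measure Ω)
    (N₀ : Ω → ℕ) (Q₀ C₀ : Ω → ℝ≥0)
    (N : List ℕ → Ω → ℕ) (Q C : List ℕ → Ω → ℝ≥0) : Prop where
  measurable_N : ∀ u, Measurable (N u)
  measurable_Q : ∀ u, Measurable (Q u)
  measurable_C : ∀ u, Measurable (C u)
  identDistrib_N : ∀ u, IdentDistrib (N u) N₀ μ μ
  identDistrib_Q : ∀ u, IdentDistrib (Q u) Q₀ μ μ
  identDistrib_C : ∀ u, IdentDistrib (C u) C₀ μ μ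
  indep : iIndepFun (Sum.elim (fun u ω => (N u ω : ℝ≥0)) (Sum.elim Q C)) μ

variable {Ω : Type*}

/-- The `n`-th generation of the random tree: the root is the empty sequence, and the children of
an individual `u` are the sequences `u ++ [i]`, `0 ≤ i < N u`. -/
def generation (N : List ℕ → Ω → ℕ) (ω : Ω) : ℕ → Finset (List ℕ)
  | 0 => {[]}
  | n + 1 => (generation N ω n).biUnion fun u => (Finset.range (N u ω)).image fun i => u ++ [i]

/-- The weight of the individual `u = (i₁, …, iₙ)`: the product of the variables
`C (i₁, …, iₖ)`, `1 ≤ k ≤ n`, along the branch from the root to `u`. The root has weight `1`. -/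
def weight (C : List ℕ → Ω → ℝ≥0) (u : List ℕ) (ω : Ω) : ℝ≥0 :=
  ∏ k ∈ Finset.range u.length, C (u.take (k + 1)) ω

/-- The total weight `W n = ∑ Q u * weight u` of the `n`-th generation. -/
def W (N : List ℕ → Ω → ℕ) (Q C : List ℕ → Ω → ℝ≥0) (n : ℕ) (ω : Ω) : ℝ≥0 :=
  ∑ u ∈ generation N ω n, Q u ω * weight C u ω

/-- The total weight `R = ∑ₖ W k` of the tree, the limit of the partial sums
`W 0 + ⋯ + W n`, as an element of `[0, ∞]`. -/
noncomputable def R (N : List ℕ → Ω → ℕ) (Q C : List ℕ → Ω → ℝ≥0) (ω : Ω) : ℝ≥0∞ :=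
  ∑' k, (W N Q C k ω : ℝ≥0∞)

end WeightedBranching

/-! Let R_n be the weight of the first n generations (`partialWeight`); it increases to R. Splitting
the tree at the root gives R_{n+1} = Q + ∑_{i<N} X_{n,i}, where the X_{n,i} are independent of each
other and of N, and distributed as C·R_n with C and R_n independent (`SmoothingRecursion`).

Write G(x) = P(N > x). Such a sum exceeds a large x in essentially two ways. Either N exceeds x /
E[X_{n,0}], which by the law of large numbers contributes E[X_{n,0}]^α G(x), or a single summand
exceeds x, which contributes E[N] P(C·R_n > x). If P(R_n > x) is about h·G(x), the latter is about
ρ_α h G(x) by Breiman's lemma. The term Q is negligible because it has a moment of order larger than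
α. So the tail constant evolves by h ↦ m^α + ρ_α h, a contraction; with m = lim E[X_{n,0}] =
E[C]E[Q]/(1-ρ) its fixed point is the asserted limit.

For the lower bound one large n suffices, since R ≥ R_n (`exists_eventually_le`). The upper bound
needs one threshold for all n (`eventually_forall_le`). It rests on `exists_randomSum_le`, which is
uniform over all summands with given bounds on the mean and on a moment of order β in (1, min(2,
α)); the remaining way of exceeding x, by many moderate summands, is excluded by a Chernoff bound
for truncated sums. By convexity E[N]E[C^β] ≤ max(ρ, ρ_α) < 1, so the moments of order β of the R_n
stay bounded (`exists_lintegral_partialWeight_rpow_le`). -/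

/-- A positive antitone function, bounded by one, which is regularly varying at infinity with
index `-α`. -/
structure RegVarTail (α : ℝ) (G : ℝ → ℝ) : Prop where
  anti : Antitone G
  pos : ∀ x, 0 < G x
  le_one : ∀ x, G x ≤ 1
  tendsto_ratio : ∀ t : ℝ, 0 < t → Tendsto (fun x => G (t * x) / G x) atTop (𝓝 (t ^ (-α)))

/-! ### Regular variation: Potter bounds and Breiman's lemma -/

namespace RegVarTail

variable {α : ℝ} {G : ℝ → ℝ}

theorem eventually_le_mul (hG : RegVarTail α G) {t c : ℝ} (ht : 0 < t) (hc : t ^ (-α) < c) :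
    ∀ᶠ x in atTop, G (t * x) ≤ c * G x := by
  filter_upwards [(hG.tendsto_ratio t ht).eventually_lt_const hc] with x hx
  rw [div_lt_iff₀ (hG.pos x)] at hx
  exact hx.le

theorem eventually_mul_le (hG : RegVarTail α G) {t c : ℝ} (ht : 0 < t) (hc : c < t ^ (-α)) :
    ∀ᶠ x in atTop, c * G x ≤ G (t * x) := by
  filter_upwards [(hG.tendsto_ratio t ht).eventually_const_lt hc] with x hx
  rw [lt_div_iff₀ (hG.pos x)] at hx
  exact hx.le

/-- Iteration of a doubling inequality along x, 2x, 4x, .... No sign of `G` is assumed, so that `-G`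
gives the reverse inequality. -/
theorem pow_two_bound {G : ℝ → ℝ} {a b x₀ : ℝ} (ha : 0 ≤ a) (hx₀ : 0 < x₀)
    (h : ∀ x, x₀ ≤ x → a * G x ≤ b * G (2 * x)) (hb : 0 ≤ b) (k : ℕ) {x : ℝ} (hx : x₀ ≤ x) :
    a ^ k * G x ≤ b ^ k * G (2 ^ k * x) := by
  induction k with
  | zero => simp
  | succ k ih =>
    have h1 : x₀ ≤ 2 ^ k * x := by
      have : (1 : ℝ) ≤ 2 ^ k := one_le_pow₀ (by norm_num)
      nlinarith
    calc a ^ (k + 1) * G x = a * (a ^ k * G x) := by ring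
      _ ≤ a * (b ^ k * G (2 ^ k * x)) := by gcongr
      _ = b ^ k * (a * G (2 ^ k * x)) := by ring
      _ ≤ b ^ k * (b * G (2 * (2 ^ k * x))) :=
          mul_le_mul_of_nonneg_left (h _ h1) (by positivity)
      _ = b ^ (k + 1) * G (2 ^ (k + 1) * x) := by ring_nf

theorem exists_two_pow {c : ℝ} (hc : 1 ≤ c) : ∃ k : ℕ, (2 : ℝ) ^ k ≤ c ∧ c ≤ 2 ^ (k + 1) := by
  obtain ⟨k, h1, h2⟩ := exists_nat_pow_near hc (by norm_num : (1 : ℝ) < 2)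
  exact ⟨k, h1, h2.le⟩

/-- Potter's lower bound. -/
theorem exists_le_rpow_mul (hG : RegVarTail α G) {p : ℝ} (hp : α < p) (hp0 : 0 < p) :
    ∃ K > 0, ∃ x₀ > 0, ∀ c y : ℝ, 1 ≤ c → x₀ ≤ c * y → G y ≤ K * c ^ p * G (c * y) := by
  have h2 : (2 : ℝ) ^ (-p) < 2 ^ (-α) := by
    apply Real.rpow_lt_rpow_of_exponent_lt <;> linarith
  obtain ⟨x₁, hx₁⟩ := eventually_atTop.1 (hG.eventually_mul_le two_pos h2)
  set x₀ := max x₁ 1 with hx₀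
  have hx₀1 : 0 < x₀ := lt_of_lt_of_le one_pos (le_max_right _ _)
  have key : ∀ c y : ℝ, 1 ≤ c → x₀ ≤ y → G y ≤ 2 ^ p * c ^ p * G (c * y) := by
    intro c y hc hy
    have hy0 : 0 < y := hx₀1.trans_le hy
    obtain ⟨k, hk1, hk2⟩ := exists_two_pow hc
    have := pow_two_bound (a := 2 ^ (-p)) (b := 1) (by positivity) hx₀1
      (fun x hx => by simpa using hx₁ x ((le_max_left _ _).trans hx)) zero_le_one (k + 1) hy
    rw [one_pow, one_mul, Real.rpow_neg two_pos.le, inv_pow, inv_mul_le_iff₀ (by positivity)]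
      at this
    refine this.trans ?_
    have e1 : ((2 : ℝ) ^ p) ^ (k + 1) ≤ 2 ^ p * c ^ p := by
      rw [pow_succ, mul_comm, ← Real.rpow_natCast ((2 : ℝ) ^ p), ← Real.rpow_mul two_pos.le,
        mul_comm p, Real.rpow_mul two_pos.le, Real.rpow_natCast]
      gcongr
    have e2 : G (2 ^ (k + 1) * y) ≤ G (c * y) := hG.anti (by gcongr)
    exact mul_le_mul e1 e2 (hG.pos _).le (by positivity)
  -- Division by `G x₀` makes the constant large enough for `y < x₀`, where only `G y ≤ 1` is
  -- available.
  refine ⟨2 ^ p / G x₀, div_pos (by positivity) (hG.pos _), x₀, hx₀1, fun c y hc hcy => ?_⟩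
  have hGx := hG.pos x₀
  have hcp : 0 < c ^ p := by positivity
  rcases le_or_gt x₀ y with hy | hy
  · refine (key c y hc hy).trans ?_
    have : (2 : ℝ) ^ p ≤ 2 ^ p / G x₀ := by
      rw [le_div_iff₀ hGx]
      exact mul_le_of_le_one_right (by positivity) (hG.le_one _)
    have := hG.pos (c * y)
    gcongr
  -- The doubling argument cannot start at `y`; it starts at `x₀` and reaches `c * y` with the
  -- smaller factor `c * y / x₀ ≤ c`.
  · have hd : 1 ≤ c * y / x₀ := by rwa [le_div_iff₀ hx₀1, one_mul]
    have := key (c * y / x₀) x₀ hd le_rfl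
    rw [div_mul_cancel₀ _ hx₀1.ne'] at this
    have h3 : (c * y / x₀) ^ p ≤ c ^ p := by
      apply Real.rpow_le_rpow (by linarith) _ hp0.le
      rw [div_le_iff₀ hx₀1]
      gcongr
    have h4 : G x₀ ≤ 2 ^ p * c ^ p * G (c * y) := by
      refine this.trans ?_
      have := hG.pos (c * y)
      gcongr
    refine (hG.le_one y).trans ?_
    rw [show 2 ^ p / G x₀ * c ^ p * G (c * y) = (2 ^ p * c ^ p * G (c * y)) / G x₀ by ring,
      le_div_iff₀ hGx, one_mul]
    exact h4

/-- A regularly varying tail decays faster than any power smaller than its index. -/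
theorem exists_le_rpow (hG : RegVarTail α G) {p : ℝ} (hp : p < α) (hp0 : 0 < p) :
    ∃ K > 0, ∀ x : ℝ, 0 < x → G x ≤ K * x ^ (-p) := by
  have h2 : (2 : ℝ) ^ (-α) < 2 ^ (-p) := by
    apply Real.rpow_lt_rpow_of_exponent_lt <;> linarith
  obtain ⟨x₁, hx₁⟩ := eventually_atTop.1 (hG.eventually_le_mul two_pos h2)
  set x₀ := max x₁ 1 with hx₀
  have hx₀1 : 0 < x₀ := lt_of_lt_of_le one_pos (le_max_right _ _)
  refine ⟨(2 * x₀) ^ p, by positivity, fun x hx => ?_⟩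
  rcases le_or_gt x₀ x with h | h
  · obtain ⟨k, hk1, hk2⟩ := exists_two_pow ((one_le_div hx₀1).2 h)
    have := pow_two_bound (G := fun x => - G x) (a := 2 ^ (-p)) (b := 1) (by positivity) hx₀1
      (fun x hx => by simpa using hx₁ x ((le_max_left _ _).trans hx)) zero_le_one k le_rfl
    simp only [one_pow, one_mul, mul_neg, neg_le_neg_iff] at this
    have e0 : G x ≤ G (2 ^ k * x₀) := by
      apply hG.anti
      rwa [le_div_iff₀ hx₀1] at hk1
    refine e0.trans (this.trans ?_)
    refine (mul_le_of_le_one_right (by positivity) (hG.le_one _)).trans ?_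
    rw [Real.rpow_neg two_pos.le, Real.rpow_neg hx.le, inv_pow, ← div_eq_mul_inv,
      le_div_iff₀ (by positivity), inv_mul_le_iff₀ (by positivity), ← Real.rpow_natCast,
      ← Real.rpow_mul two_pos.le, mul_comm p, Real.rpow_mul two_pos.le, Real.rpow_natCast,
      ← Real.mul_rpow (by positivity) (by positivity)]
    apply Real.rpow_le_rpow hx.le _ hp0.le
    rw [div_le_iff₀ hx₀1] at hk2
    calc x ≤ _ := hk2
      _ = _ := by ring
  · refine (hG.le_one x).trans ?_
    rw [Real.rpow_neg hx.le, ← div_eq_mul_inv, one_le_div (by positivity)]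
    apply Real.rpow_le_rpow hx.le _ hp0.le
    linarith

/-- Powers larger than the index are negligible with respect to the tail. -/
theorem eventually_rpow_le (hG : RegVarTail α G) {p : ℝ} (hp : α < p) (hp0 : 0 < p)
    {δ : ℝ} (hδ : 0 < δ) (A : ℝ) : ∀ᶠ x in atTop, A * x ^ (-p) ≤ δ * G x := by
  -- With `max α 0 < q < p`, Potter's bound from the point 1 makes `G x` at least a multiple of `x ^
  -- (-q)`, to which `x ^ (-p)` is negligible.
  obtain ⟨q, hq1, hq2⟩ := exists_between (max_lt hp hp0)
  have hq0 : 0 < q := (le_max_right _ _).trans_lt hq1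
  obtain ⟨K, hK, x₀, hx₀, h⟩ := hG.exists_le_rpow_mul ((le_max_left _ _).trans_lt hq1) hq0
  have hlim : Tendsto (fun x : ℝ => |A| * x ^ (-(p - q))) atTop (𝓝 (|A| * 0)) :=
    (tendsto_rpow_neg_atTop (by linarith)).const_mul _
  rw [mul_zero] at hlim
  have hpos : 0 < δ * (G 1 / K) := mul_pos hδ (div_pos (hG.pos 1) hK)
  filter_upwards [hlim.eventually_le_const hpos, eventually_ge_atTop (max 1 x₀)] with x hx hx1
  have hx1' : 1 ≤ x := (le_max_left _ _).trans hx1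
  have hx0 : 0 < x := by linarith
  have h1 := h x 1 hx1' (by rw [mul_one]; exact (le_max_right _ _).trans hx1)
  rw [mul_one] at h1
  have h2 : G 1 / K * x ^ (-q) ≤ G x := by
    rw [Real.rpow_neg hx0.le, ← div_eq_mul_inv, div_div, div_le_iff₀ (by positivity)]
    linarith
  calc A * x ^ (-p) ≤ |A| * x ^ (-p) := by gcongr; exact le_abs_self A
    _ = |A| * x ^ (-(p - q)) * x ^ (-q) := by
        rw [mul_assoc, ← Real.rpow_add hx0]; ring_nf
    _ ≤ δ * (G 1 / K) * x ^ (-q) := by gcongr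
    _ = δ * (G 1 / K * x ^ (-q)) := by ring
    _ ≤ δ * G x := by gcongr

/-- Breiman's lemma: the tail at `x / C`, averaged over `C`, is asymptotic to `E[C ^ α]` times the
tail at `x`. -/
theorem tendsto_integral_div (hG : RegVarTail α G) (hα : 0 < α) {Ω : Type*} [MeasurableSpace Ω]
    {μ : Measure Ω} [IsProbabilityMeasure μ] {C : Ω → ℝ} (hCm : Measurable C) (hC0 : ∀ ω, 0 ≤ C ω)
    {p : ℝ} (hp : α < p) (hCp : Integrable (fun ω => C ω ^ p) μ) :
    Tendsto (fun x => (∫ ω, (if 0 < C ω then G (x / C ω) else 0) ∂μ) / G x) atTop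
      (𝓝 (∫ ω, C ω ^ α ∂μ)) := by
  have hp0 : 0 < p := hα.trans hp
  obtain ⟨K, hK, x₀, hx₀, h⟩ := hG.exists_le_rpow_mul hp hp0
  have hGm : Measurable G := hG.anti.measurable
  simp_rw [← integral_div]
  -- The ratio is at most 1 where `C < 1`, by monotonicity, and at most `K * C ^ p` where `C ≥ 1`,
  -- by Potter's bound. The value 0 at `C = 0` stands for G(∞); Lean's `x / 0` would give `G 0 > 0`.
  apply tendsto_integral_filter_of_dominated_convergence (fun ω => 1 + K * C ω ^ p)
  · refine Eventually.of_forall fun x => Measurable.aestronglyMeasurable ?_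
    exact (Measurable.ite (measurableSet_lt measurable_const hCm)
      (hGm.comp (measurable_const.div hCm)) measurable_const).div_const _
  · filter_upwards [eventually_ge_atTop x₀] with x hx
    refine Eventually.of_forall fun ω => ?_
    have hx0 : 0 < x := hx₀.trans_le hx
    have hCp0 : 0 ≤ C ω ^ p := Real.rpow_nonneg (hC0 ω) _
    have hGx := hG.pos x
    split_ifs with hc
    · rw [Real.norm_of_nonneg (div_nonneg (hG.pos _).le hGx.le), div_le_iff₀ hGx]
      rcases le_or_gt 1 (C ω) with h1 | h1
      · have h2 := h (C ω) (x / C ω) h1 (by rwa [mul_div_cancel₀ _ hc.ne'])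
        rw [mul_div_cancel₀ _ hc.ne'] at h2
        linarith
      · have h2 : G (x / C ω) ≤ G x := by
          apply hG.anti
          rw [le_div_iff₀ hc]
          nlinarith
        have : 0 ≤ K * C ω ^ p * G x := by positivity
        linarith
    · simp only [zero_div, norm_zero]
      positivity
  · exact (integrable_const _).add (hCp.const_mul _)
  · refine Eventually.of_forall fun ω => ?_
    split_ifs with hc
    · have := hG.tendsto_ratio (C ω)⁻¹ (by positivity)
      rw [Real.inv_rpow hc.le, Real.rpow_neg hc.le, inv_inv] at this
      refine this.congr fun x => ?_
      rw [div_eq_inv_mul x (C ω)]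
    · have : C ω = 0 := le_antisymm (not_lt.1 hc) (hC0 ω)
      simp [this, Real.zero_rpow hα.ne']

/-- A random variable with regularly varying tail of index `-α` has moments of all orders
below `α`. -/
theorem integrable_rpow (hG : RegVarTail α G) {Ω : Type*} [MeasurableSpace Ω] {μ : Measure Ω}
    [IsProbabilityMeasure μ] {X : Ω → ℝ} (hXm : Measurable X) (hX0 : ∀ ω, 0 ≤ X ω)
    (hX : ∀ x, 0 < x → μ.real {ω | x < X ω} = G x) {β : ℝ} (hβ0 : 0 < β) (hβ : β < α) :
    Integrable (fun ω => X ω ^ β) μ := by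
  obtain ⟨q, hq1, hq2⟩ := exists_between hβ
  obtain ⟨K, hK, h⟩ := hG.exists_le_rpow hq2 (hβ0.trans hq1)
  have hlt : ∫⁻ ω, ENNReal.ofReal (X ω ^ β) ∂μ < ∞ := by
    rw [lintegral_rpow_eq_lintegral_meas_lt_mul μ (ae_of_all _ hX0) hXm.aemeasurable hβ0]
    refine ENNReal.mul_lt_top ENNReal.ofReal_lt_top ?_
    have i1 : IntegrableOn (fun t : ℝ => t ^ (β - 1)) (Set.Ioc 0 1) :=
      (intervalIntegrable_iff_integrableOn_Ioc_of_le zero_le_one).1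
        (intervalIntegral.intervalIntegrable_rpow' (by linarith))
    have i2 : IntegrableOn (fun t : ℝ => K * t ^ (-q + (β - 1))) (Set.Ioi 1) :=
      (integrableOn_Ioi_rpow_of_lt (by linarith) one_pos).const_mul K
    -- In the layer cake integral the tail is bounded by 1 up to level 1, and by `K * t ^ (-q)` with
    -- `β < q < α` beyond it.
    rw [← Set.Ioc_union_Ioi_eq_Ioi zero_le_one]
    refine (lintegral_union_le _ _ _).trans_lt (ENNReal.add_lt_top.2 ⟨?_, ?_⟩)
    · refine lt_of_le_of_lt (setLIntegral_mono' measurableSet_Ioc fun t ht => ?_)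
        (hasFiniteIntegral_iff_ofReal ?_ |>.1 i1.2)
      · exact mul_le_of_le_one_left (by positivity) prob_le_one
      · filter_upwards [ae_restrict_mem measurableSet_Ioc] with t ht
        exact Real.rpow_nonneg ht.1.le _
    · refine lt_of_le_of_lt (setLIntegral_mono' measurableSet_Ioi fun t ht => ?_)
        (hasFiniteIntegral_iff_ofReal ?_ |>.1 i2.2)
      · have ht0 : (0 : ℝ) < t := one_pos.trans ht
        rw [← ofReal_measureReal, hX t ht0, ← ENNReal.ofReal_mul (hG.pos t).le,
          Real.rpow_add ht0, ← mul_assoc]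
        apply ENNReal.ofReal_le_ofReal
        gcongr
        exact h t ht0
      · filter_upwards [ae_restrict_mem measurableSet_Ioi] with t ht
        have ht0 : (0 : ℝ) < t := one_pos.trans ht
        positivity
  refine ⟨(hXm.pow_const β).aestronglyMeasurable, ?_⟩
  rwa [hasFiniteIntegral_iff_ofReal (ae_of_all _ fun ω => Real.rpow_nonneg (hX0 ω) _)]

end RegVarTail

/-! ### Sums of a fixed number of independent summands -/

/-- A sequence of independent, identically distributed, nonnegative, integrable random
variables. -/
structure IsIIDNonneg {Ω : Type*} [MeasurableSpace Ω] (μ : Measure Ω) (X : ℕ → Ω → ℝ) : Prop where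
  measurable : ∀ i, Measurable (X i)
  nonneg : ∀ i ω, 0 ≤ X i ω
  indep : iIndepFun X μ
  ident : ∀ i, IdentDistrib (X i) (X 0) μ μ
  integrable : Integrable (X 0) μ

/-- For `u ≤ 1` the quadratic remainder of the exponential is at most u² ≤ u^β; for `u > 1` the last
term alone suffices. It bounds a moment generating function by a mean and a moment of order `β` when
there need be no variance. -/
theorem Real.exp_le_one_add_add_rpow_mul_exp {u β : ℝ} (hu : 0 ≤ u) (hβ0 : 0 < β) (hβ : β ≤ 2) :
    Real.exp u ≤ 1 + u + u ^ β * Real.exp u := by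
  have h1 : 1 ≤ Real.exp u := Real.one_le_exp hu
  rcases le_or_gt u 1 with h | h
  · have h2 := (abs_le.1 (Real.abs_exp_sub_one_sub_id_le (by rwa [abs_of_nonneg hu]))).2
    have h3 : u ^ 2 ≤ u ^ β := by
      rw [← Real.rpow_natCast]
      exact Real.rpow_le_rpow_of_exponent_ge_of_imp hu h (by simpa using hβ) (by intro _ h; norm_num at h)
    have h4 : 0 ≤ u ^ β := by positivity
    nlinarith
  · have : 1 ≤ u ^ β := Real.one_le_rpow h.le hβ0.le
    nlinarith

namespace IsIIDNonneg

variable {Ω : Type*} [MeasurableSpace Ω] {μ : Measure Ω} {X : ℕ → Ω → ℝ}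

theorem measureReal_lt (hX : IsIIDNonneg μ X) (i : ℕ) (y : ℝ) :
    μ.real {ω | y < X i ω} = μ.real {ω | y < X 0 ω} := by
  exact congrArg ENNReal.toReal ((hX.ident i).measure_mem_eq (measurableSet_Ioi (a := y)))

theorem integrable_all (hX : IsIIDNonneg μ X) (i : ℕ) : Integrable (X i) μ :=
  (hX.ident i).integrable_iff.2 hX.integrable

variable [IsProbabilityMeasure μ]

/-- Exponential bound for sums of truncated variables. -/
theorem measureReal_sum_truncated_le (hX : IsIIDNonneg μ X) {β m M y θ : ℝ} (hβ0 : 0 < β)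
    (hβ : β ≤ 2) (hm : ∫ ω, X 0 ω ∂μ ≤ m) (hi : Integrable (fun ω => X 0 ω ^ β) μ)
    (hM : ∫ ω, X 0 ω ^ β ∂μ ≤ M) (hθ : 0 ≤ θ) (n : ℕ) (a : ℝ) :
    μ.real {ω | a < ∑ i ∈ Finset.range n, if X i ω ≤ y then X i ω else 0} ≤
      Real.exp (-θ * a + n * (θ * m + θ ^ β * Real.exp (θ * y) * M)) := by
  set φ : ℝ → ℝ := fun t => if t ≤ y then t else 0 with hφ
  have hφm : Measurable φ := Measurable.ite measurableSet_Iic measurable_id measurable_const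
  set Y : ℕ → Ω → ℝ := fun i ω => φ (X i ω) with hY
  have hYm : ∀ i, Measurable (Y i) := fun i => hφm.comp (hX.measurable i)
  have hYi : iIndepFun Y μ := hX.indep.comp (fun _ => φ) fun _ => hφm
  have hYb : ∀ i ω, Y i ω ≤ max y 0 := fun i ω => by
    simp only [hY, hφ]
    split_ifs with h
    · exact h.trans (le_max_left _ _)
    · exact le_max_right _ _
  have hY0 : ∀ i ω, 0 ≤ Y i ω := fun i ω => by
    simp only [hY, hφ]
    split_ifs with h
    · exact hX.nonneg i ω
    · exact le_rfl
  -- Truncation bounds the exponential factor in the remainder by exp(θy); above `y` the truncated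
  -- variable is 0 and the bound is trivial.
  have hE : ∀ ω, Real.exp (θ * Y 0 ω) ≤
      1 + θ * X 0 ω + θ ^ β * Real.exp (θ * y) * X 0 ω ^ β := by
    intro ω
    have hx := hX.nonneg 0 ω
    simp only [hY, hφ]
    split_ifs with h
    · refine (Real.exp_le_one_add_add_rpow_mul_exp (mul_nonneg hθ hx) hβ0 hβ).trans ?_
      rw [Real.mul_rpow hθ hx]
      have : Real.exp (θ * X 0 ω) ≤ Real.exp (θ * y) := by gcongr
      have h3 : 0 ≤ θ ^ β * X 0 ω ^ β := by positivity
      nlinarith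
    · simp only [mul_zero, Real.exp_zero]
      have : 0 ≤ θ * X 0 ω + θ ^ β * Real.exp (θ * y) * X 0 ω ^ β := by positivity
      linarith
  have hint : ∀ i, Integrable (fun ω => Real.exp (θ * Y i ω)) μ := fun i => by
    refine Integrable.of_bound (((hYm i).const_mul θ).exp).aestronglyMeasurable
      (Real.exp (θ * max y 0)) (ae_of_all _ fun ω => ?_)
    rw [Real.norm_of_nonneg (Real.exp_pos _).le]
    have := hYb i ω
    gcongr
  have hmgf0 : mgf (Y 0) μ θ ≤ Real.exp (θ * m + θ ^ β * Real.exp (θ * y) * M) := by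
    have h1 : mgf (Y 0) μ θ ≤ 1 + θ * m + θ ^ β * Real.exp (θ * y) * M := by
      calc mgf (Y 0) μ θ
          ≤ ∫ ω, (1 + θ * X 0 ω + θ ^ β * Real.exp (θ * y) * X 0 ω ^ β) ∂μ :=
            integral_mono (hint 0) (((integrable_const _).add (hX.integrable.const_mul _)).add
              (hi.const_mul _)) hE
        _ = 1 + θ * ∫ ω, X 0 ω ∂μ + θ ^ β * Real.exp (θ * y) * ∫ ω, X 0 ω ^ β ∂μ := by
            have i1 : Integrable (fun ω => 1 + θ * X 0 ω) μ :=
              (integrable_const _).add (hX.integrable.const_mul _)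
            rw [integral_add i1 (hi.const_mul _),
              integral_add (integrable_const _) (hX.integrable.const_mul _),
              integral_const_mul, integral_const_mul]
            simp
        _ ≤ _ := by gcongr
    refine h1.trans ?_
    have := Real.add_one_le_exp (θ * m + θ ^ β * Real.exp (θ * y) * M)
    linarith
  have hmgf : ∀ i, mgf (Y i) μ θ = mgf (Y 0) μ θ := fun i => by
    have : IdentDistrib (fun ω => Real.exp (θ * Y i ω)) (fun ω => Real.exp (θ * Y 0 ω)) μ μ :=
      (hX.ident i).comp (u := fun t => Real.exp (θ * φ t)) (hφm.const_mul θ).exp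
    exact this.integral_eq
  have hsum : (fun ω => ∑ i ∈ Finset.range n, Y i ω) = ∑ i ∈ Finset.range n, Y i := by
    ext ω; simp
  calc μ.real {ω | a < ∑ i ∈ Finset.range n, Y i ω}
      ≤ μ.real {ω | a ≤ ∑ i ∈ Finset.range n, Y i ω} :=
        measureReal_mono fun ω (h : a < _) => h.le
    _ ≤ Real.exp (-θ * a) * mgf (fun ω => ∑ i ∈ Finset.range n, Y i ω) μ θ := by
        apply measure_ge_le_exp_mul_mgf a hθ
        have := hYi.integrable_exp_mul_sum (t := θ) (s := Finset.range n) hYm fun i _ => hint i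
        simpa using this
    _ ≤ Real.exp (-θ * a) * Real.exp (θ * m + θ ^ β * Real.exp (θ * y) * M) ^ n := by
        rw [hsum, hYi.mgf_sum hYm]
        simp_rw [hmgf]
        rw [Finset.prod_const, Finset.card_range]
        have : 0 ≤ mgf (Y 0) μ θ := mgf_nonneg
        gcongr
    _ = _ := by rw [← Real.exp_nat_mul, ← Real.exp_add]

/-- Markov's inequality for the sum of all but one of the variables. -/
theorem measureReal_sum_erase_le (hX : IsIIDNonneg μ X) {m e : ℝ} (he : 0 < e)
    (hm : ∫ ω, X 0 ω ∂μ ≤ m) {n i : ℕ} :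
    μ.real {ω | e < ∑ j ∈ (Finset.range n).erase i, X j ω} ≤ min 1 (n * m / e) := by
  have hm0 : 0 ≤ m := (integral_nonneg (hX.nonneg 0)).trans hm
  refine le_min measureReal_le_one ?_
  rw [le_div_iff₀ he, mul_comm]
  calc e * μ.real {ω | e < ∑ j ∈ (Finset.range n).erase i, X j ω}
      ≤ e * μ.real {ω | e ≤ ∑ j ∈ (Finset.range n).erase i, X j ω} := by
        refine mul_le_mul_of_nonneg_left (measureReal_mono fun ω hω => ?_) he.le
        rw [Set.mem_ofPred_eq] at hω ⊢
        exact hω.le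
    _ ≤ ∫ ω, ∑ j ∈ (Finset.range n).erase i, X j ω ∂μ :=
        mul_meas_ge_le_integral_of_nonneg
          (ae_of_all _ fun ω => Finset.sum_nonneg fun j _ => hX.nonneg j ω)
          (integrable_finsetSum _ fun j _ => hX.integrable_all j) e
    _ = ∑ j ∈ (Finset.range n).erase i, ∫ ω, X 0 ω ∂μ := by
        rw [integral_finsetSum _ fun j _ => hX.integrable_all j]
        exact Finset.sum_congr rfl fun j _ => (hX.ident j).integral_eq
    _ ≤ ∑ j ∈ (Finset.range n).erase i, m := Finset.sum_le_sum fun _ _ => hm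
    _ ≤ ∑ j ∈ Finset.range n, m :=
        Finset.sum_le_sum_of_subset_of_nonneg (Finset.erase_subset _ _) fun _ _ _ => hm0
    _ = n * m := by simp

/-- A sum exceeding `s + e` has a summand exceeding `s`, or a summand exceeding `y` while the
others add up to more than `e`, or the sum of the summands truncated at `y` exceeds `s + e`. -/
theorem measureReal_sum_le (hX : IsIIDNonneg μ X) {m e : ℝ} (he : 0 < e)
    (hm : ∫ ω, X 0 ω ∂μ ≤ m) (n : ℕ) (s y : ℝ) :
    μ.real {ω | s + e < ∑ i ∈ Finset.range n, X i ω} ≤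
      n * μ.real {ω | s < X 0 ω} + n * min 1 (n * m / e) * μ.real {ω | y < X 0 ω} +
      μ.real {ω | s + e < ∑ i ∈ Finset.range n, if X i ω ≤ y then X i ω else 0} := by
  have hsub : {ω | s + e < ∑ i ∈ Finset.range n, X i ω} ⊆
      ((⋃ i ∈ Finset.range n, {ω | s < X i ω}) ∪
        ⋃ i ∈ Finset.range n, ({ω | y < X i ω} ∩
          {ω | e < ∑ j ∈ (Finset.range n).erase i, X j ω})) ∪
      {ω | s + e < ∑ i ∈ Finset.range n, if X i ω ≤ y then X i ω else 0} := by
    intro ω hω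
    simp only [Set.mem_ofPred_eq] at hω
    by_contra hcon
    simp only [Set.mem_union, Set.mem_iUnion, Set.mem_inter_iff, Set.mem_ofPred_eq, not_or,
      not_exists, not_and, not_lt] at hcon
    obtain ⟨⟨h1, h2⟩, h3⟩ := hcon
    by_cases hall : ∀ i ∈ Finset.range n, X i ω ≤ y
    · rw [Finset.sum_congr rfl fun i hi => if_pos (hall i hi)] at h3
      linarith
    · push Not at hall
      obtain ⟨i, hi, hiy⟩ := hall
      have := h2 i hi hiy
      have h4 := h1 i hi
      rw [← Finset.add_sum_erase _ _ hi] at hω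
      linarith
  refine (measureReal_mono hsub).trans ((measureReal_union_le _ _).trans ?_)
  gcongr
  refine (measureReal_union_le _ _).trans ?_
  gcongr
  · refine (measureReal_biUnion_finset_le _ _).trans ?_
    simp [hX.measureReal_lt]
  · refine (measureReal_biUnion_finset_le _ _).trans ?_
    have : ∀ i ∈ Finset.range n, μ.real ({ω | y < X i ω} ∩
        {ω | e < ∑ j ∈ (Finset.range n).erase i, X j ω}) ≤
        min 1 (n * m / e) * μ.real {ω | y < X 0 ω} := by
      intro i _
      have hind : IndepFun (∑ j ∈ (Finset.range n).erase i, X j) (X i) μ :=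
        hX.indep.indepFun_finsetSum_of_notMem hX.measurable (Finset.notMem_erase i _)
      have := hind.measure_inter_preimage_eq_mul _ _ (measurableSet_Ioi (a := e))
        (measurableSet_Ioi (a := y))
      have h2 := congrArg ENNReal.toReal this
      rw [ENNReal.toReal_mul] at h2
      have e1 : (∑ j ∈ (Finset.range n).erase i, X j) ⁻¹' Set.Ioi e =
          {ω | e < ∑ j ∈ (Finset.range n).erase i, X j ω} := by ext; simp
      have e2 : X i ⁻¹' Set.Ioi y = {ω | y < X i ω} := rfl
      rw [e1, e2] at h2
      rw [Set.inter_comm]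
      calc _ = _ := h2
        _ ≤ _ := mul_le_mul (hX.measureReal_sum_erase_le he hm) (hX.measureReal_lt i y).le
          ENNReal.toReal_nonneg (by
            have : 0 ≤ m := (integral_nonneg (hX.nonneg 0)).trans hm
            positivity)
    refine (Finset.sum_le_sum this).trans ?_
    simp [mul_assoc]

end IsIIDNonneg

/-! ### Conditioning, and sums of a random number of summands -/

theorem MeasureTheory.measurable_measure_section {Ω E F : Type*} [MeasurableSpace Ω]
    [MeasurableSpace E] [MeasurableSpace F] {μ : Measure Ω} [IsProbabilityMeasure μ]
    {U : Ω → E} {V : Ω → F} (hU : Measurable U) (hV : Measurable V)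
    {B : Set (E × F)} (hB : MeasurableSet B) :
    Measurable fun ω => μ {ω' | (U ω, V ω') ∈ B} := by
  have e : (fun ω => μ {ω' | (U ω, V ω') ∈ B}) = (fun u => (μ.map V) (Prod.mk u ⁻¹' B)) ∘ U :=
    funext fun ω => (Measure.map_apply hV (measurable_prodMk_left hB)).symm
  rw [e]
  have := Measure.isProbabilityMeasure_map (μ := μ) hV.aemeasurable
  exact (measurable_measure_prodMk_left hB).comp hU

theorem MeasureTheory.integrable_measureReal_section {Ω E F : Type*} [MeasurableSpace Ω]
    [MeasurableSpace E] [MeasurableSpace F] {μ : Measure Ω} [IsProbabilityMeasure μ]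
    {U : Ω → E} {V : Ω → F} (hU : Measurable U) (hV : Measurable V)
    {B : Set (E × F)} (hB : MeasurableSet B) :
    Integrable (fun ω => μ.real {ω' | (U ω, V ω') ∈ B}) μ := by
  refine Integrable.of_bound
    (measurable_measure_section hU hV hB).ennreal_toReal.aestronglyMeasurable 1
    (ae_of_all _ fun ω => ?_)
  rw [Real.norm_of_nonneg measureReal_nonneg]
  exact measureReal_le_one

/-- Computing the probability of an event determined by two independent random variables by
conditioning on the first one. -/
theorem ProbabilityTheory.IndepFun.measureReal_eq_integral {Ω E F : Type*} [MeasurableSpace Ω]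
    [MeasurableSpace E] [MeasurableSpace F] {μ : Measure Ω} [IsProbabilityMeasure μ]
    {U : Ω → E} {V : Ω → F} (h : IndepFun U V μ) (hU : Measurable U) (hV : Measurable V)
    {B : Set (E × F)} (hB : MeasurableSet B) :
    μ.real {ω | (U ω, V ω) ∈ B} = ∫ ω, μ.real {ω' | (U ω, V ω') ∈ B} ∂μ := by
  have h1 : μ {ω | (U ω, V ω) ∈ B} = ∫⁻ ω, μ {ω' | (U ω, V ω') ∈ B} ∂μ := by
    have e1 : μ {ω | (U ω, V ω) ∈ B} = (μ.map fun ω => (U ω, V ω)) B :=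
      (Measure.map_apply (hU.prodMk hV) hB).symm
    have := Measure.isProbabilityMeasure_map (μ := μ) hV.aemeasurable
    rw [e1, (indepFun_iff_map_prod_eq_prod_map_map hU.aemeasurable hV.aemeasurable).1 h,
      Measure.prod_apply hB, lintegral_map (measurable_measure_prodMk_left hB) hU]
    refine lintegral_congr fun ω => ?_
    rw [Measure.map_apply hV (measurable_prodMk_left hB)]
    rfl
  rw [measureReal_def, h1, ← integral_toReal (measurable_measure_section hU hV hB).aemeasurable
    (ae_of_all _ fun ω => measure_lt_top _ _)]
  rfl

namespace IsIIDNonneg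

variable {Ω : Type*} [MeasurableSpace Ω] {μ : Measure Ω}

/-- The minimum with 1 lets `N` itself dominate, so a finite mean is enough; E[N²] may be infinite.
-/
theorem tendsto_integral_mul_min {N : Ω → ℕ} (hNm : Measurable N)
    (hNi : Integrable (fun ω => (N ω : ℝ)) μ) {a : ℝ → ℝ} (ha0 : ∀ᶠ x in atTop, 0 ≤ a x)
    (ha : Tendsto a atTop (𝓝 0)) :
    Tendsto (fun x => ∫ ω, N ω * min 1 (N ω * a x) ∂μ) atTop (𝓝 0) := by
  have hN' : Measurable fun ω => (N ω : ℝ) := measurable_from_nat.comp hNm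
  have : Tendsto (fun x => ∫ ω, N ω * min 1 (N ω * a x) ∂μ) atTop (𝓝 (∫ ω, (0 : ℝ) ∂μ)) := by
    apply tendsto_integral_filter_of_dominated_convergence (fun ω => (N ω : ℝ))
    · refine Eventually.of_forall fun x => Measurable.aestronglyMeasurable ?_
      exact hN'.mul (measurable_const.min (hN'.mul_const _))
    · filter_upwards [ha0] with x hx
      refine ae_of_all _ fun ω => ?_
      rw [Real.norm_of_nonneg (by positivity)]
      exact mul_le_of_le_one_right (by positivity) (min_le_left _ _)
    · exact hNi
    · refine ae_of_all _ fun ω => ?_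
      have h1 : Tendsto (fun x => (N ω : ℝ) * min 1 (N ω * a x)) atTop
          (𝓝 ((N ω : ℝ) * min 1 ((N ω : ℝ) * 0))) := (tendsto_const_nhds.min (ha.const_mul _)).const_mul _
      simpa using h1
  simpa using this

theorem integrable_mul_min {N : Ω → ℕ} (hNm : Measurable N)
    (hNi : Integrable (fun ω => (N ω : ℝ)) μ) {a : ℝ} (ha0 : 0 ≤ a) :
    Integrable (fun ω => N ω * min 1 (N ω * a)) μ := by
  have hN' : Measurable fun ω => (N ω : ℝ) := measurable_from_nat.comp hNm
  refine hNi.mono' (hN'.mul (measurable_const.min (hN'.mul_const _))).aestronglyMeasurable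
    (ae_of_all _ fun ω => ?_)
  rw [Real.norm_of_nonneg (by positivity)]
  exact mul_le_of_le_one_right (by positivity) (min_le_left _ _)

variable [IsProbabilityMeasure μ]

/-- Uniform polynomial bounds for sums of variables truncated at a small multiple of the level. -/
theorem exists_truncated_le {β m ε p : ℝ} (hβ1 : 1 < β) (hβ : β ≤ 2) (hm0 : 0 < m) (M : ℝ)
    (hε : 0 < ε) (hp : 0 < p) :
    ∃ γ > 0, ∀ᶠ x in atTop, ∀ X : ℕ → Ω → ℝ, IsIIDNonneg μ X → ∫ ω, X 0 ω ∂μ ≤ m →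
      Integrable (fun ω => X 0 ω ^ β) μ → ∫ ω, X 0 ω ^ β ∂μ ≤ M →
      ∀ n : ℕ, n * m ≤ (1 - 2 * ε) * x →
      μ.real {ω | (1 - ε) * x < ∑ i ∈ Finset.range n, if X i ω ≤ γ * x then X i ω else 0} ≤
        Real.exp 1 * x ^ (-p) := by
  -- The Chernoff parameter will be θ = κ log x / x. As nm ≤ (1-2ε)x, the linear part of the
  -- exponent is at most -εθx = -p log x. The choice of γ gives exp(θγx) = x^((β-1)/2), so the
  -- remainder is O((log x)^β x^(-(β-1)/2)), eventually at most 1; this is the factor `Real.exp 1`.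
  set κ := p / ε with hκ
  have hκ0 : 0 < κ := div_pos hp hε
  set γ := (β - 1) / (2 * κ) with hγ
  have hγ0 : 0 < γ := div_pos (by linarith) (by linarith)
  refine ⟨γ, hγ0, ?_⟩
  have hlim : Tendsto (fun x : ℝ => |M| / m * κ ^ β * (Real.log x ^ β / x ^ ((β - 1) / 2)))
      atTop (𝓝 (|M| / m * κ ^ β * 0)) :=
    ((isLittleO_log_rpow_rpow_atTop β (by linarith)).tendsto_div_nhds_zero).const_mul _
  rw [mul_zero] at hlim
  filter_upwards [hlim.eventually_le_const one_pos, eventually_gt_atTop 1] with x hx hx1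
  intro X hX hXm hXi hXM n hn
  have hx0 : 0 < x := by linarith
  have hlog : 0 < Real.log x := Real.log_pos hx1
  set θ := κ * Real.log x / x with hθ
  have hθ0 : 0 ≤ θ := by positivity
  have hM0 : 0 ≤ M :=
    (integral_nonneg fun ω => Real.rpow_nonneg (hX.nonneg 0 ω) β).trans hXM
  refine (hX.measureReal_sum_truncated_le (by linarith) hβ hXm hXi hXM hθ0 n _).trans ?_
  rw [Real.rpow_def_of_pos hx0, ← Real.exp_add]
  apply Real.exp_le_exp.2
  have hθx : θ * x = κ * Real.log x := by rw [hθ]; field_simp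
  have hexp : Real.exp (θ * (γ * x)) = x ^ ((β - 1) / 2) := by
    rw [Real.rpow_def_of_pos hx0, show θ * (γ * x) = θ * x * γ by ring, hθx, hγ]
    congr 1
    field_simp
  have hnx : (n : ℝ) ≤ x / m := by
    rw [le_div_iff₀ hm0]
    nlinarith
  have hmain : n * (θ ^ β * Real.exp (θ * (γ * x)) * M) ≤ 1 := by
    refine le_trans ?_ hx
    calc n * (θ ^ β * Real.exp (θ * (γ * x)) * M)
        ≤ x / m * (θ ^ β * Real.exp (θ * (γ * x)) * M) := by gcongr
      _ = |M| / m * κ ^ β * (Real.log x ^ β / x ^ ((β - 1) / 2)) := by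
        rw [hexp, abs_of_nonneg hM0, hθ, Real.div_rpow (by positivity) hx0.le,
          Real.mul_rpow hκ0.le hlog.le]
        have e1 : x ^ β = x * (x ^ ((β - 1) / 2) * x ^ ((β - 1) / 2)) := by
          rw [← Real.rpow_add hx0, ← Real.rpow_one_add' hx0.le (by linarith)]
          ring_nf
        rw [e1]
        have : x ^ ((β - 1) / 2) ≠ 0 := (Real.rpow_pos_of_pos hx0 _).ne'
        field_simp
  have h2 : n * (θ * m) ≤ (1 - 2 * ε) * (θ * x) := by nlinarith
  have h3 : θ * x * ε = p * Real.log x := by rw [hθx, hκ]; field_simp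
  nlinarith

theorem measurableSet_sum_range {p : ℕ → Prop} (a : ℝ) :
    MeasurableSet {z : ℕ × (ℕ → ℝ) | p z.1 ∧ a < ∑ i ∈ Finset.range z.1, z.2 i} := by
  refine MeasurableSet.inter (measurable_fst (MeasurableSet.of_discrete (s := {n | p n}))) ?_
  have : Measurable fun z : ℕ × (ℕ → ℝ) => ∑ i ∈ Finset.range z.1, z.2 i :=
    measurable_from_prod_countable_right fun n =>
      Finset.measurable_sum (f := fun i (y : ℕ → ℝ) => y i) (Finset.range n) fun i _ =>
        measurable_pi_apply i
  exact measurableSet_lt measurable_const this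

/-- Upper bound for the tail of a random sum, uniform over summands with bounded moments. -/
theorem exists_randomSum_le {α : ℝ} {G : ℝ → ℝ} (hG : RegVarTail α G) (hα : 0 < α)
    {N : Ω → ℕ} (hNm : Measurable N) (hNi : Integrable (fun ω => (N ω : ℝ)) μ)
    (hN : ∀ x, 0 < x → μ.real {ω | x < (N ω : ℝ)} = G x)
    {Q : Ω → ℝ} (hQ : ∀ c, 0 < c → ∀ η, 0 < η → ∀ᶠ x in atTop, μ.real {ω | c * x < Q ω} ≤ η * G x)
    {β m ε : ℝ} (hβ1 : 1 < β) (hβ : β ≤ 2) (hm0 : 0 < m) (M : ℝ) (hε : 0 < ε) (hε2 : ε < 1 / 2) :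
    ∃ γ > 0, ∀ η > 0, ∀ᶠ x in atTop, ∀ X : ℕ → Ω → ℝ, IsIIDNonneg μ X →
      IndepFun N (fun ω i => X i ω) μ → ∫ ω, X 0 ω ∂μ ≤ m →
      Integrable (fun ω => X 0 ω ^ β) μ → ∫ ω, X 0 ω ^ β ∂μ ≤ M →
      μ.real {ω | x < Q ω + ∑ i ∈ Finset.range (N ω), X i ω} ≤
        G ((1 - 2 * ε) / m * x) + (∫ ω, (N ω : ℝ) ∂μ) * μ.real {ω | (1 - 2 * ε) * x < X 0 ω} +
          η * μ.real {ω | γ * x < X 0 ω} + η * G x := by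
  -- Any exponent larger than α would do in place of `α + 1`: the truncated part is then negligible
  -- with respect to `G`.
  obtain ⟨γ, hγ, htr⟩ := exists_truncated_le (μ := μ) hβ1 hβ hm0 M hε (by linarith : 0 < α + 1)
  refine ⟨γ, hγ, fun η hη => ?_⟩
  have ha : Tendsto (fun x : ℝ => m / (ε * x)) atTop (𝓝 0) :=
    tendsto_const_nhds.div_atTop (tendsto_id.const_mul_atTop hε)
  have ha0 : ∀ᶠ x : ℝ in atTop, 0 ≤ m / (ε * x) := by
    filter_upwards [eventually_gt_atTop 0] with x hx
    positivity
  filter_upwards [htr, hQ ε hε (η / 2) (by positivity),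
    hG.eventually_rpow_le (by linarith : α < α + 1) (by linarith) (half_pos hη) (Real.exp 1),
    (tendsto_integral_mul_min hNm hNi ha0 ha).eventually_le_const hη, ha0,
    eventually_gt_atTop 0] with x h1 h2 h3 h4 h5 hx0
  intro X hX hNX hXm hXi hXM
  set s := (1 - 2 * ε) * x with hs
  set e := ε * x with he
  have he0 : 0 < e := by positivity
  -- Either `Q` exceeds εx, or `N` is so large that the mean of the sum exceeds (1-2ε)x, or the sum
  -- exceeds its conditional mean by at least εx. In the last case `measureReal_sum_le` is applied
  -- conditionally on `N`.
  have hsub : {ω | x < Q ω + ∑ i ∈ Finset.range (N ω), X i ω} ⊆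
      ({ω | ε * x < Q ω} ∪ {ω | (1 - 2 * ε) / m * x < N ω}) ∪
      {ω | N ω * m ≤ s ∧ s + e < ∑ i ∈ Finset.range (N ω), X i ω} := by
    intro ω hω
    by_contra hcon
    simp only [Set.mem_union, Set.mem_ofPred_eq, not_or, not_and, not_lt] at hcon hω
    obtain ⟨⟨c1, c2⟩, c3⟩ := hcon
    have : N ω * m ≤ s := by
      rw [div_mul_eq_mul_div, le_div_iff₀ hm0] at c2
      exact c2
    have := c3 this
    simp only [hs, he] at this
    linarith
  have hlast : μ.real {ω | N ω * m ≤ s ∧ s + e < ∑ i ∈ Finset.range (N ω), X i ω} ≤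
      (∫ ω, (N ω : ℝ) ∂μ) * μ.real {ω | s < X 0 ω} + η * μ.real {ω | γ * x < X 0 ω} +
        η / 2 * G x := by
    have hB := measurableSet_sum_range (p := fun n => (n : ℝ) * m ≤ s) (s + e)
    have := hNX.measureReal_eq_integral hNm (measurable_pi_lambda _ hX.measurable) hB
    simp only [Set.mem_ofPred_eq] at this
    rw [this]
    have hi1 : Integrable (fun ω => (N ω : ℝ) * μ.real {ω | s < X 0 ω}) μ := hNi.mul_const _
    have hi2 : Integrable (fun ω => N ω * min 1 (N ω * (m / e)) *
        μ.real {ω | γ * x < X 0 ω}) μ := (integrable_mul_min hNm hNi h5).mul_const _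
    have hi12 : Integrable (fun ω => (N ω : ℝ) * μ.real {ω | s < X 0 ω} +
      N ω * min 1 (N ω * (m / e)) * μ.real {ω | γ * x < X 0 ω}) μ := hi1.add hi2
    calc _ ≤ ∫ ω, ((N ω : ℝ) * μ.real {ω | s < X 0 ω} +
        N ω * min 1 (N ω * (m / e)) * μ.real {ω | γ * x < X 0 ω} + η / 2 * G x) ∂μ := by
          refine integral_mono_of_nonneg (ae_of_all _ fun ω => measureReal_nonneg)
            (hi12.add (integrable_const _)) (ae_of_all _ fun ω => ?_)
          have hGx := hG.pos x
          by_cases hc : (N ω : ℝ) * m ≤ s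
          · simp only [hc, true_and]
            refine (hX.measureReal_sum_le he0 hXm (N ω) s (γ * x)).trans ?_
            rw [mul_div_assoc]
            gcongr
            have := h1 X hX hXm hXi hXM (N ω) hc
            rw [show s + e = (1 - ε) * x by simp only [hs, he]; ring]
            exact this.trans h3
          · simp only [hc, false_and, Set.ofPred_false, measureReal_empty]
            positivity
      _ = (∫ ω, (N ω : ℝ) ∂μ) * μ.real {ω | s < X 0 ω} +
          (∫ ω, N ω * min 1 (N ω * (m / e)) ∂μ) * μ.real {ω | γ * x < X 0 ω} + η / 2 * G x := by
          rw [integral_add hi12 (integrable_const _), integral_add hi1 hi2, integral_mul_const,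
            integral_mul_const]
          simp
      _ ≤ _ := by gcongr
  have hb0 : 0 < (1 - 2 * ε) / m * x := by
    have : 0 < 1 - 2 * ε := by linarith
    positivity
  calc _ ≤ _ := measureReal_mono hsub
    _ ≤ _ := measureReal_union_le _ _
    _ ≤ _ := add_le_add_left (measureReal_union_le _ _) _
    _ ≤ _ := add_le_add (add_le_add h2 (hN _ hb0).le) hlast
    _ = _ := by ring

/-- The weak law of large numbers, as a lower bound. -/
theorem eventually_le_measureReal_sum {X : ℕ → Ω → ℝ} (hX : IsIIDNonneg μ X) {c δ : ℝ}
    (hc : c < ∫ ω, X 0 ω ∂μ) (hδ : 0 < δ) :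
    ∀ᶠ n : ℕ in atTop, 1 - δ ≤ μ.real {ω | n * c < ∑ i ∈ Finset.range n, X i ω} := by
  set m := ∫ ω, X 0 ω ∂μ with hm
  have hslln := strong_law_ae_real X hX.integrable
    (fun i j hij => hX.indep.indepFun hij) hX.ident
  have hSm : ∀ n : ℕ, Measurable fun ω => ∑ i ∈ Finset.range n, X i ω := fun n =>
    Finset.measurable_sum _ fun i _ => hX.measurable i
  have hmeas := tendstoInMeasure_of_tendsto_ae
    (fun n : ℕ => ((hSm n).div_const (n : ℝ)).aestronglyMeasurable) hslln
  have h1 := hmeas (ENNReal.ofReal (m - c)) (by simpa using hc)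
  have h2 := (ENNReal.tendsto_toReal ENNReal.zero_ne_top).comp h1
  filter_upwards [h2.eventually_le_const (by simpa using hδ), eventually_gt_atTop 0] with n hn hn0
  have hms : MeasurableSet {ω | n * c < ∑ i ∈ Finset.range n, X i ω} :=
    measurableSet_lt measurable_const (hSm n)
  have hcompl : μ.real {ω | n * c < ∑ i ∈ Finset.range n, X i ω}ᶜ ≤ δ := by
    refine le_trans (measureReal_mono ?_) hn
    intro ω hω
    simp only [Set.mem_compl_iff, Set.mem_ofPred_eq, not_lt] at hω ⊢
    rw [edist_dist, Real.dist_eq]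
    apply ENNReal.ofReal_le_ofReal
    have : (∑ i ∈ Finset.range n, X i ω) / n ≤ c := by
      rw [div_le_iff₀ (by positivity)]
      linarith
    rw [abs_sub_comm]
    refine le_trans ?_ (le_abs_self _)
    linarith
  rw [probReal_compl_eq_one_sub hms] at hcompl
  linarith

/-- A Bonferroni type lower bound for the tail of a maximum. -/
theorem le_measureReal_exists_lt {X : ℕ → Ω → ℝ} (hX : IsIIDNonneg μ X) (n : ℕ) (x : ℝ) :
    n * μ.real {ω | x < X 0 ω} - n * min 1 (n * μ.real {ω | x < X 0 ω}) * μ.real {ω | x < X 0 ω}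
      ≤ μ.real {ω | ∃ i ∈ Finset.range n, x < X i ω} := by
  set p := μ.real {ω | x < X 0 ω} with hp
  have hp0 : 0 ≤ p := measureReal_nonneg
  have hp1 : p ≤ 1 := measureReal_le_one
  have hms : MeasurableSet {ω | ∃ i ∈ Finset.range n, x < X i ω} := by
    have : {ω | ∃ i ∈ Finset.range n, x < X i ω} = ⋃ i ∈ Finset.range n, {ω | x < X i ω} := by
      ext; simp
    rw [this]
    exact Finset.measurableSet_biUnion _ fun i _ =>
      measurableSet_lt measurable_const (hX.measurable i)
  have hcompl : μ.real {ω | ∃ i ∈ Finset.range n, x < X i ω}ᶜ = (1 - p) ^ n := by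
    have e : {ω | ∃ i ∈ Finset.range n, x < X i ω}ᶜ =
        ⋂ i ∈ Finset.range n, X i ⁻¹' Set.Iic x := by
      ext; simp
    rw [e, measureReal_def, hX.indep.measure_inter_preimage_eq_mul _
      (fun _ _ => measurableSet_Iic), ENNReal.toReal_prod]
    have : ∀ i ∈ Finset.range n, (μ (X i ⁻¹' Set.Iic x)).toReal = 1 - p := by
      intro i _
      rw [hp, ← hX.measureReal_lt i, ← probReal_compl_eq_one_sub
        (measurableSet_lt measurable_const (hX.measurable i)), measureReal_def]
      congr 2
      ext; simp
    rw [Finset.prod_congr rfl this]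
    simp
  have key : ∀ k : ℕ, (1 - p) ^ k ≤ 1 - k * p + k * (k * p) * p := by
    intro k
    induction k with
    | zero => simp
    | succ k ih =>
      have h1 : 0 ≤ 1 - p := by linarith
      have h2 := mul_le_mul_of_nonneg_right ih h1
      rw [pow_succ]
      push_cast
      have hk : (0 : ℝ) ≤ k := by positivity
      nlinarith [mul_nonneg (mul_nonneg hk hk) (mul_nonneg (mul_nonneg hp0 hp0) hp0),
        mul_nonneg hk (mul_nonneg hp0 hp0), mul_nonneg hp0 hp0]
  have hE : μ.real {ω | ∃ i ∈ Finset.range n, x < X i ω} = 1 - (1 - p) ^ n := by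
    rw [← hcompl, probReal_compl_eq_one_sub hms]; ring
  -- If np ≥ 1 the lower bound is 0. The minimum with 1 is kept in order to integrate over `N`
  -- knowing only its mean.
  rcases le_total 1 (n * p) with h | h
  · rw [min_eq_left h]
    simp
  · rw [min_eq_right h, hE]
    linarith [key n]

/-- Lower bound for the tail of a random sum: either the number of summands is large, or one of
the summands is. -/
theorem eventually_le_randomSum {G : ℝ → ℝ}
    {N : Ω → ℕ} (hNm : Measurable N) (hNi : Integrable (fun ω => (N ω : ℝ)) μ)
    (hN : ∀ x, 0 < x → μ.real {ω | x < (N ω : ℝ)} = G x)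
    {Q : Ω → ℝ} (hQ0 : ∀ ω, 0 ≤ Q ω)
    {X : ℕ → Ω → ℝ} (hX : IsIIDNonneg μ X) (hNX : IndepFun N (fun ω i => X i ω) μ)
    {b c δ : ℝ} (hb : 0 < b) (hc : 0 ≤ c) (hδ : 0 < δ)
    (hlaw : ∀ᶠ n : ℕ in atTop, c ≤ μ.real {ω | n / b < ∑ i ∈ Finset.range n, X i ω}) :
    ∀ᶠ x in atTop, c * G (b * x) + (∫ ω, (N ω : ℝ) ∂μ - δ) * μ.real {ω | x < X 0 ω} ≤
      μ.real {ω | x < Q ω + ∑ i ∈ Finset.range (N ω), X i ω} := by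
  have hN' : Measurable fun ω => (N ω : ℝ) := measurable_from_nat.comp hNm
  have htail : Tendsto (fun x => μ.real {ω | x < X 0 ω}) atTop (𝓝 0) := by
    have h0 : Tendsto (fun x : ℝ => (∫ ω, X 0 ω ∂μ) / x) atTop (𝓝 0) :=
      tendsto_const_nhds.div_atTop tendsto_id
    refine squeeze_zero' (Eventually.of_forall fun x => measureReal_nonneg) ?_ h0
    filter_upwards [eventually_gt_atTop 0] with x hx
    rw [le_div_iff₀ hx, mul_comm]
    refine le_trans (mul_le_mul_of_nonneg_left (measureReal_mono fun ω hω => ?_) hx.le)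
      (mul_meas_ge_le_integral_of_nonneg (ae_of_all _ (hX.nonneg 0)) hX.integrable x)
    rw [Set.mem_ofPred_eq] at hω ⊢
    exact hω.le
  have hlim1 : Tendsto (fun x => ∫ ω, (if (N ω : ℝ) ≤ b * x then (N ω : ℝ) else 0) ∂μ) atTop
      (𝓝 (∫ ω, (N ω : ℝ) ∂μ)) := by
    apply tendsto_integral_filter_of_dominated_convergence (fun ω => (N ω : ℝ))
    · exact Eventually.of_forall fun x => (Measurable.ite (measurableSet_le hN' measurable_const)
        hN' measurable_const).aestronglyMeasurable
    · refine Eventually.of_forall fun x => ae_of_all _ fun ω => ?_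
      split_ifs <;> simp
    · exact hNi
    · refine ae_of_all _ fun ω => tendsto_const_nhds.congr' ?_
      filter_upwards [eventually_ge_atTop (N ω / b)] with x hx
      rw [div_le_iff₀ hb] at hx
      rw [if_pos (by linarith)]
  have hlim2 := tendsto_integral_mul_min hNm hNi
    (Eventually.of_forall fun x => measureReal_nonneg) htail
  obtain ⟨n₀, hn₀⟩ := eventually_atTop.1 hlaw
  filter_upwards [hlim1.eventually_const_le (show ∫ ω, (N ω : ℝ) ∂μ - δ / 2 < _ by linarith),
    hlim2.eventually_le_const (half_pos hδ), eventually_gt_atTop 0,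
    eventually_ge_atTop (n₀ / b)] with x h1 h2 hx0 hxn
  set p := μ.real {ω | x < X 0 ω} with hp
  have hp0 : 0 ≤ p := measureReal_nonneg
  have hVm : Measurable fun ω i => X i ω := measurable_pi_lambda _ hX.measurable
  -- The cases `N > b * x` and `N ≤ b * x` are disjoint, so their contributions add. On the first,
  -- `N ≥ n₀` and `N / b > x`, so `hlaw` applies; on the second, the truncated mean of `N` tends to
  -- its mean.
  set A := {ω | b * x < N ω ∧ x < ∑ i ∈ Finset.range (N ω), X i ω} with hA
  set B := {ω | N ω ≤ b * x ∧ ∃ i ∈ Finset.range (N ω), x < X i ω} with hB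
  have hSA := measurableSet_sum_range (p := fun n => b * x < (n : ℝ)) x
  have hSB : MeasurableSet {z : ℕ × (ℕ → ℝ) | (z.1 : ℝ) ≤ b * x ∧
      ∃ i ∈ Finset.range z.1, x < z.2 i} := by
    have h1 : MeasurableSet {z : ℕ × (ℕ → ℝ) | (z.1 : ℝ) ≤ b * x} :=
      measurable_fst (MeasurableSet.of_discrete (s := {n : ℕ | (n : ℝ) ≤ b * x}))
    refine MeasurableSet.inter (s₂ := {z | ∃ i ∈ Finset.range z.1, x < z.2 i}) h1 ?_
    have : {z : ℕ × (ℕ → ℝ) | ∃ i ∈ Finset.range z.1, x < z.2 i} =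
        ⋃ i, ({z | i ∈ Finset.range z.1} ∩ {z | x < z.2 i}) := by
      ext; simp
    rw [this]
    refine MeasurableSet.iUnion fun i => MeasurableSet.inter
      (measurable_fst (MeasurableSet.of_discrete (s := {n | i ∈ Finset.range n}))) ?_
    exact measurableSet_lt measurable_const (by fun_prop)
  have hAB : Disjoint A B := by
    rw [Set.disjoint_left]
    rintro ω ⟨ha, _⟩ ⟨hb, _⟩
    exact absurd hb (not_le.2 ha)
  have hBm : MeasurableSet B := hSB.preimage (hNm.prodMk hVm)
  have hAsub : A ∪ B ⊆ {ω | x < Q ω + ∑ i ∈ Finset.range (N ω), X i ω} := by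
    rintro ω (⟨_, h⟩ | ⟨_, i, hi, h⟩)
    · have := hQ0 ω
      simp only [Set.mem_ofPred_eq]
      linarith
    · have := hQ0 ω
      have h3 := Finset.single_le_sum (f := fun i => X i ω) (fun i _ => hX.nonneg i ω) hi
      simp only [Set.mem_ofPred_eq] at h3 ⊢
      linarith
  have hPA : c * G (b * x) ≤ μ.real A := by
    have := hNX.measureReal_eq_integral hNm hVm hSA
    simp only [Set.mem_ofPred_eq] at this
    rw [hA, this, ← hN _ (by positivity : 0 < b * x), mul_comm, ← smul_eq_mul,
      ← setIntegral_const, ← integral_indicator (measurableSet_lt measurable_const hN')]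
    refine integral_mono_of_nonneg (ae_of_all _ fun ω => ?_) ?_ (ae_of_all _ fun ω => ?_)
    · exact Set.indicator_nonneg (fun _ _ => hc) _
    · exact integrable_measureReal_section hNm hVm hSA
    · by_cases h : b * x < N ω
      · rw [Set.indicator_of_mem (by exact h)]
        simp only [h, true_and]
        have hnn : n₀ ≤ N ω := by
          rw [div_le_iff₀ hb] at hxn
          have : (n₀ : ℝ) ≤ N ω := by linarith
          exact_mod_cast this
        refine (hn₀ _ hnn).trans (measureReal_mono fun ω' hω' => ?_)
        simp only [Set.mem_ofPred_eq] at hω' ⊢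
        refine lt_trans ?_ hω'
        rw [lt_div_iff₀ hb]
        linarith
      · rw [Set.indicator_of_notMem (by exact h)]
        exact measureReal_nonneg
  have hPB : (∫ ω, (N ω : ℝ) ∂μ - δ) * p ≤ μ.real B := by
    have := hNX.measureReal_eq_integral hNm hVm hSB
    simp only [Set.mem_ofPred_eq] at this
    rw [hB, this]
    have hi1 : Integrable (fun ω => if (N ω : ℝ) ≤ b * x then (N ω : ℝ) else 0) μ := by
      refine hNi.mono' (Measurable.ite (measurableSet_le hN' measurable_const)
        hN' measurable_const).aestronglyMeasurable (ae_of_all _ fun ω => ?_)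
      split_ifs <;> simp
    have hi2 := integrable_mul_min hNm hNi hp0
    calc (∫ ω, (N ω : ℝ) ∂μ - δ) * p
        ≤ ((∫ ω, (if (N ω : ℝ) ≤ b * x then (N ω : ℝ) else 0) ∂μ) -
            ∫ ω, N ω * min 1 (N ω * p) ∂μ) * p :=
          mul_le_mul_of_nonneg_right (by linarith) hp0
      _ = ∫ ω, ((if (N ω : ℝ) ≤ b * x then (N ω : ℝ) else 0) - N ω * min 1 (N ω * p)) * p ∂μ := by
          rw [integral_mul_const, integral_sub hi1 hi2]
      _ ≤ _ := by
        refine integral_mono ((hi1.sub hi2).mul_const p) ?_ fun ω => ?_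
        · exact integrable_measureReal_section hNm hVm hSB
        · by_cases h : (N ω : ℝ) ≤ b * x
          · simp only [h, if_true, true_and]
            rw [sub_mul]
            exact hX.le_measureReal_exists_lt (N ω) x
          · simp only [h, if_false, false_and, Set.ofPred_false, measureReal_empty]
            have : 0 ≤ N ω * min 1 (N ω * p) * p := by positivity
            linarith
  calc _ ≤ μ.real A + μ.real B := add_le_add hPA hPB
    _ = μ.real (A ∪ B) := (measureReal_union hAB hBm).symm
    _ ≤ _ := measureReal_mono hAsub

end IsIIDNonneg

/-! ### Independence of blocks -/

/-- If a family of random variables indexed by pairs is independent, then so are its blocks. -/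
theorem ProbabilityTheory.iIndepFun.curry {Ω ι : Type*} {mΩ : MeasurableSpace Ω} {P : Measure Ω}
    {κ : ι → Type*} {E : (i : ι) → κ i → Type*} [∀ i j, MeasurableSpace (E i j)]
    {X : (i : ι) → (j : κ i) → Ω → E i j} (mX : ∀ i j, Measurable (X i j))
    (h : iIndepFun (fun (p : (i : ι) × (κ i)) ω => X p.1 p.2 ω) P) :
    iIndepFun (fun i ω => (X i · ω)) P := by
  have := h.isProbabilityMeasure
  have hp : ∀ i j, IsProbabilityMeasure (P.map (X i j)) :=
    fun i j => Measure.isProbabilityMeasure_map (mX i j).aemeasurable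
  have e : (MeasurableEquiv.piCurry E) ∘ (fun ω p => X p.1 p.2 ω) = fun ω i j => X i j ω := by
    ext; simp [Sigma.curry]
  have hblock : ∀ i, iIndepFun (X i) P := fun i =>
    h.precomp (g := fun j : κ i => (⟨i, j⟩ : (i : ι) × κ i)) fun a b hab => by simpa using hab
  rw [iIndepFun_iff_map_fun_eq_infinitePi_map (by fun_prop), ← e,
    ← Measure.map_map (by fun_prop) (by fun_prop),
    (iIndepFun_iff_map_fun_eq_infinitePi_map (by fun_prop)).1 h,
    Measure.infinitePi_map_piCurry (fun i j => P.map (X i j))]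
  congr with i
  rw [(iIndepFun_iff_map_fun_eq_infinitePi_map (by fun_prop)).1 (hblock i)]

/-- In an independent family, each variable is independent of all the others. -/
theorem ProbabilityTheory.iIndepFun.indepFun_compl {Ω ι : Type*} {mΩ : MeasurableSpace Ω}
    {P : Measure Ω} {E : ι → Type*} [∀ i, MeasurableSpace (E i)] {Z : (i : ι) → Ω → E i}
    (mZ : ∀ i, Measurable (Z i)) (h : iIndepFun Z P) (i₀ : ι) :
    IndepFun (Z i₀) (fun ω (i : {i // i ≠ i₀}) => Z i ω) P := by
  rw [IndepFun_iff_Indep]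
  have hdis : Disjoint ({i₀} : Set ι) {i₀}ᶜ := disjoint_compl_right
  have := indep_iSup_of_disjoint (fun i => (mZ i).comap_le) h.iIndep hdis
  refine indep_of_indep_of_le_left (indep_of_indep_of_le_right this ?_) ?_
  · rw [MeasurableSpace.pi, MeasurableSpace.comap_iSup]
    refine iSup_le fun i => ?_
    rw [MeasurableSpace.comap_comp]
    exact le_iSup₂_of_le i.1 i.2 le_rfl
  · exact le_iSup₂_of_le i₀ rfl le_rfl

/-! ### The recursion at the root of the tree -/

namespace WeightedBranching

variable {Ω : Type*}

/-- The total weight of the first `n` generations. -/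
noncomputable def partialWeight (N : List ℕ → Ω → ℕ) (Q C : List ℕ → Ω → ℝ≥0) (n : ℕ) (ω : Ω) :
    ℝ≥0 :=
  ∑ k ∈ Finset.range n, W N Q C k ω

section Recursion

variable (N : List ℕ → Ω → ℕ) (Q C : List ℕ → Ω → ℝ≥0) (ω : Ω)

/-- The definition of `generation` appends the last letter. Splitting off the first letter instead
exhibits the subtrees rooted at the children of the root. -/
theorem generation_succ' (n : ℕ) :
    generation N ω (n + 1) = (Finset.range (N [] ω)).biUnion fun i =>
      (generation (fun u => N (i :: u)) ω n).image (List.cons i) := by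
  induction n with
  | zero => ext u; simp [generation, eq_comm]
  | succ n ih =>
    rw [generation, ih]
    ext u
    simp only [Finset.mem_biUnion, Finset.mem_image, Finset.mem_range, generation]
    constructor
    · rintro ⟨v, ⟨i, hi, w, hw, rfl⟩, j, hj, rfl⟩
      exact ⟨i, hi, w ++ [j], ⟨w, hw, j, hj, rfl⟩, rfl⟩
    · rintro ⟨i, hi, v, ⟨w, hw, j, hj, rfl⟩, rfl⟩
      exact ⟨i :: w, ⟨i, hi, w, hw, rfl⟩, j, hj, rfl⟩

theorem weight_cons (i : ℕ) (u : List ℕ) :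
    weight C (i :: u) ω = C [i] ω * weight (fun u => C (i :: u)) u ω := by
  simp [weight, Finset.prod_range_succ', mul_comm]

theorem W_zero : W N Q C 0 ω = Q [] ω := by
  simp [W, generation, weight]

theorem W_succ (n : ℕ) :
    W N Q C (n + 1) ω = ∑ i ∈ Finset.range (N [] ω), C [i] ω *
      W (fun u => N (i :: u)) (fun u => Q (i :: u)) (fun u => C (i :: u)) n ω := by
  rw [W, generation_succ', Finset.sum_biUnion]
  · refine Finset.sum_congr rfl fun i _ => ?_
    rw [Finset.sum_image (by intro a _ b _ h; simpa using h), W, Finset.mul_sum]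
    refine Finset.sum_congr rfl fun u _ => ?_
    rw [weight_cons]
    ring
  · intro i _ j _ hij
    rw [Function.onFun, Finset.disjoint_left]
    simp only [Finset.mem_image]
    rintro _ ⟨u, _, rfl⟩ ⟨v, _, h⟩
    simp only [List.cons.injEq] at h
    exact hij h.1.symm

/-- The smoothing recursion, valid pointwise and not only in law. The first n + 1 generations
consist of the root and of the first n generations of each subtree; `partialWeight` at 0 is the
empty sum 0. -/
theorem partialWeight_succ (n : ℕ) :
    partialWeight N Q C (n + 1) ω = Q [] ω + ∑ i ∈ Finset.range (N [] ω), C [i] ω *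
      partialWeight (fun u => N (i :: u)) (fun u => Q (i :: u)) (fun u => C (i :: u)) n ω := by
  simp only [partialWeight, Finset.sum_range_succ', W_succ, W_zero, Finset.mul_sum]
  rw [Finset.sum_comm, add_comm]

end Recursion

section Measurability

variable [MeasurableSpace Ω] {N : List ℕ → Ω → ℕ} {Q C : List ℕ → Ω → ℝ≥0}

theorem measurable_partialWeight (hN : ∀ u, Measurable (N u)) (hQ : ∀ u, Measurable (Q u))
    (hC : ∀ u, Measurable (C u)) (n : ℕ) : Measurable (partialWeight N Q C n) := by
  induction n generalizing N Q C with
  | zero =>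
    have : partialWeight N Q C 0 = fun _ => 0 := by ext; simp [partialWeight]
    rw [this]; exact measurable_const
  | succ n ih =>
    have e : partialWeight N Q C (n + 1) = fun ω => Q [] ω +
        (fun z : ℕ × (ℕ → ℝ≥0) => ∑ i ∈ Finset.range z.1, z.2 i) (N [] ω, fun i => C [i] ω *
          partialWeight (fun u => N (i :: u)) (fun u => Q (i :: u)) (fun u => C (i :: u)) n ω) :=
      funext fun ω => partialWeight_succ N Q C ω n
    rw [e]
    have hs : Measurable fun z : ℕ × (ℕ → ℝ≥0) => ∑ i ∈ Finset.range z.1, z.2 i :=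
      measurable_from_prod_countable_right fun n =>
        Finset.measurable_sum (f := fun i (y : ℕ → ℝ≥0) => y i) (Finset.range n) fun i _ =>
          measurable_pi_apply i
    refine (hQ []).add (hs.comp ((hN []).prodMk (measurable_pi_lambda _ fun i => ?_)))
    exact (hC [i]).mul (ih (fun u => hN _) (fun u => hQ _) (fun u => hC _))

end Measurability

/-- The indices of the input variables. -/
abbrev InputIndex : Type := List ℕ ⊕ (List ℕ ⊕ List ℕ)

/-- The total weight of the first `n` generations of a tree, as a function on the canonical space of inputs. -/
noncomputable def canonicalPartialWeight (n : ℕ) (f : InputIndex → ℝ≥0) : ℝ≥0 :=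
  partialWeight (fun u f => ⌊f (Sum.inl u)⌋₊) (fun u f => f (Sum.inr (Sum.inl u)))
    (fun u f => f (Sum.inr (Sum.inr u))) n f

theorem measurable_canonicalPartialWeight (n : ℕ) : Measurable (canonicalPartialWeight n) :=
  measurable_partialWeight (fun _ => Nat.measurable_floor.comp (measurable_pi_apply _))
    (fun _ => measurable_pi_apply _) (fun _ => measurable_pi_apply _) n

theorem partialWeight_comp {Ω' : Type*} (φ : Ω → Ω') (N : List ℕ → Ω' → ℕ)
    (Q C : List ℕ → Ω' → ℝ≥0) (n : ℕ) (ω : Ω) :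
    partialWeight N Q C n (φ ω) =
      partialWeight (fun u ω => N u (φ ω)) (fun u ω => Q u (φ ω)) (fun u ω => C u (φ ω)) n ω := by
  induction n generalizing N Q C with
  | zero => simp [partialWeight]
  | succ n ih =>
    rw [partialWeight_succ, partialWeight_succ]
    congr 1
    exact Finset.sum_congr rfl fun i _ => by rw [ih]

/-- The input family, as a single family of random variables. -/
noncomputable def inputFamily (N : List ℕ → Ω → ℕ) (Q C : List ℕ → Ω → ℝ≥0) :
    InputIndex → Ω → ℝ≥0 :=
  Sum.elim (fun u ω => (N u ω : ℝ≥0)) (Sum.elim Q C)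

/-- The partial weight is one fixed measurable function of the whole input family, so equality in
law and independence of input families carry over to partial weights. The floor in
`canonicalPartialWeight` undoes the cast of `N`. -/
theorem partialWeight_eq_canonical (N : List ℕ → Ω → ℕ) (Q C : List ℕ → Ω → ℝ≥0) (n : ℕ) (ω : Ω) :
    partialWeight N Q C n ω = canonicalPartialWeight n fun j => inputFamily N Q C j ω := by
  rw [canonicalPartialWeight, partialWeight_comp (fun ω j => inputFamily N Q C j ω)]
  simp [inputFamily]

/-- The shift of the indices from a tree to the subtree rooted at the `i`-th child of the root. -/
def shiftIndex (i : ℕ) : InputIndex → InputIndex :=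
  Sum.map (List.cons i) (Sum.map (List.cons i) (List.cons i))

theorem shiftIndex_injective (i : ℕ) : Function.Injective (shiftIndex i) :=
  (List.cons_injective).sumMap ((List.cons_injective).sumMap List.cons_injective)

theorem inputFamily_shift (N : List ℕ → Ω → ℕ) (Q C : List ℕ → Ω → ℝ≥0) (i : ℕ) (j : InputIndex) :
    inputFamily (fun u => N (i :: u)) (fun u => Q (i :: u)) (fun u => C (i :: u)) j =
      inputFamily N Q C (shiftIndex i j) := by
  rcases j with u | u | u <;> rfl

/-- The contribution of the `i`-th child of the root to the total weight of the first `n + 1`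
generations. -/
noncomputable def branch (N : List ℕ → Ω → ℕ) (Q C : List ℕ → Ω → ℝ≥0) (n i : ℕ) (ω : Ω) : ℝ≥0 :=
  C [i] ω * partialWeight (fun u => N (i :: u)) (fun u => Q (i :: u)) (fun u => C (i :: u)) n ω

theorem partialWeight_succ_eq {N : List ℕ → Ω → ℕ} {Q C : List ℕ → Ω → ℝ≥0} (n : ℕ) (ω : Ω) : partialWeight N Q C (n + 1) ω =
    Q [] ω + ∑ i ∈ Finset.range (N [] ω), branch N Q C n i ω :=
  partialWeight_succ N Q C ω n

/-- The contribution of a child of the root, as a function of the shifted input family. -/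
theorem branch_eq (N : List ℕ → Ω → ℕ) (Q C : List ℕ → Ω → ℝ≥0) (n i : ℕ) (ω : Ω) :
    branch N Q C n i ω = inputFamily N Q C (shiftIndex i (Sum.inr (Sum.inr []))) ω *
      canonicalPartialWeight n fun j => inputFamily N Q C (shiftIndex i j) ω := by
  rw [branch, partialWeight_eq_canonical]
  simp only [inputFamily_shift]
  rfl

/-- The product in `weight` starts at the first generation, so the factor `C []` of the root is
never read. -/
theorem partialWeight_congr {N : List ℕ → Ω → ℕ} {Q C C' : List ℕ → Ω → ℝ≥0} {n : ℕ} {ω : Ω}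
    (hC : ∀ u, u ≠ [] → C u ω = C' u ω) :
    partialWeight N Q C n ω = partialWeight N Q C' n ω := by
  refine Finset.sum_congr rfl fun k _ => Finset.sum_congr rfl fun u _ => ?_
  congr 1
  refine Finset.prod_congr rfl fun l hl => hC _ ?_
  rintro h0
  simp only [Finset.mem_range] at hl
  simp only [List.take_eq_nil_iff, Nat.add_eq_zero_iff, one_ne_zero, and_false, false_or] at h0
  simp [h0] at hl

theorem coe_partialWeight {N : List ℕ → Ω → ℕ} {Q C : List ℕ → Ω → ℝ≥0} (n : ℕ) (ω : Ω) : (partialWeight N Q C n ω : ℝ≥0∞) =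
    ∑ k ∈ Finset.range n, (W N Q C k ω : ℝ≥0∞) := by
  rw [partialWeight]; push_cast; rfl

theorem partialWeight_mono {N : List ℕ → Ω → ℕ} {Q C : List ℕ → Ω → ℝ≥0} (ω : Ω) : Monotone fun n => partialWeight N Q C n ω :=
  fun _ _ h => Finset.sum_le_sum_of_subset_of_nonneg (Finset.range_mono h) fun _ _ _ => zero_le

theorem ofReal_lt_R_iff {N : List ℕ → Ω → ℕ} {Q C : List ℕ → Ω → ℝ≥0} {x : ℝ} (hx : 0 ≤ x) (ω : Ω) :
    ENNReal.ofReal x < R N Q C ω ↔ ∃ n, x < partialWeight N Q C n ω := by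
  rw [R, ENNReal.tsum_eq_iSup_nat, lt_iSup_iff]
  refine exists_congr fun n => ?_
  rw [← coe_partialWeight, ← ENNReal.ofReal_coe_nnreal, ENNReal.ofReal_lt_ofReal_iff_of_nonneg hx]

variable [MeasurableSpace Ω] {μ : Measure Ω}
  {N₀ : Ω → ℕ} {Q₀ C₀ : Ω → ℝ≥0} {N : List ℕ → Ω → ℕ} {Q C : List ℕ → Ω → ℝ≥0}

namespace IsInput

theorem measurable_inputFamily (h : IsInput μ N₀ Q₀ C₀ N Q C) (j : InputIndex) :
    Measurable (inputFamily N Q C j) := by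
  rcases j with u | u | u
  · exact (measurable_from_nat (f := fun k : ℕ => (k : ℝ≥0))).comp (h.measurable_N u)
  · exact h.measurable_Q u
  · exact h.measurable_C u

theorem shift (h : IsInput μ N₀ Q₀ C₀ N Q C) (i : ℕ) :
    IsInput μ N₀ Q₀ C₀ (fun u => N (i :: u)) (fun u => Q (i :: u)) (fun u => C (i :: u)) where
  measurable_N u := h.measurable_N _
  measurable_Q u := h.measurable_Q _
  measurable_C u := h.measurable_C _
  identDistrib_N u := h.identDistrib_N _
  identDistrib_Q u := h.identDistrib_Q _
  identDistrib_C u := h.identDistrib_C _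
  indep := by
    have := h.indep.precomp (shiftIndex_injective i)
    convert! this using 2 with j
    exact inputFamily_shift N Q C i j

theorem measurable_partialWeight (h : IsInput μ N₀ Q₀ C₀ N Q C) (n : ℕ) :
    Measurable (partialWeight N Q C n) :=
  WeightedBranching.measurable_partialWeight h.measurable_N h.measurable_Q h.measurable_C n

theorem measurable_branch (h : IsInput μ N₀ Q₀ C₀ N Q C) (n i : ℕ) :
    Measurable (branch N Q C n i) :=
  (h.measurable_C _).mul ((h.shift i).measurable_partialWeight n)

/-- The input families of the tree and of the subtree rooted at a child of the root have the same
joint distribution. -/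
theorem identDistrib_shift (h : IsInput μ N₀ Q₀ C₀ N Q C) (i : ℕ) :
    IdentDistrib (fun ω j => inputFamily N Q C (shiftIndex i j) ω)
      (fun ω j => inputFamily N Q C j ω) μ μ := by
  refine IdentDistrib.pi (fun j => ?_) (h.indep.precomp (shiftIndex_injective i)) h.indep
  rcases j with u | u | u
  · exact ((h.identDistrib_N (i :: u)).trans (h.identDistrib_N u).symm).comp
      (u := fun k : ℕ => (k : ℝ≥0)) measurable_from_nat
  · exact (h.identDistrib_Q (i :: u)).trans (h.identDistrib_Q u).symm
  · exact (h.identDistrib_C (i :: u)).trans (h.identDistrib_C u).symm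

theorem identDistrib_partialWeight (h : IsInput μ N₀ Q₀ C₀ N Q C) (n i : ℕ) :
    IdentDistrib (partialWeight (fun u => N (i :: u)) (fun u => Q (i :: u))
      (fun u => C (i :: u)) n) (partialWeight N Q C n) μ μ := by
  have := (h.identDistrib_shift i).comp (measurable_canonicalPartialWeight n)
  convert! this using 1
  · ext1 ω
    rw [partialWeight_eq_canonical]
    simp only [inputFamily_shift, Function.comp]
  · ext1 ω
    rw [partialWeight_eq_canonical]
    rfl

theorem measurable_branchFun (n : ℕ) : Measurable fun f : InputIndex → ℝ≥0 =>
    f (Sum.inr (Sum.inr [])) * canonicalPartialWeight n f :=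
  (measurable_pi_apply _).mul (measurable_canonicalPartialWeight n)

theorem identDistrib_branch (h : IsInput μ N₀ Q₀ C₀ N Q C) (n i : ℕ) :
    IdentDistrib (branch N Q C n i) (branch N Q C n 0) μ μ := by
  have := ((h.identDistrib_shift i).trans (h.identDistrib_shift 0).symm).comp
    (measurable_branchFun n)
  convert! this using 1 <;> exact funext fun ω => branch_eq N Q C n _ ω

theorem lintegral_N (h : IsInput μ N₀ Q₀ C₀ N Q C) {β : ℝ} :
    ∫⁻ ω, (N [] ω : ℝ≥0∞) ^ β ∂μ = ∫⁻ ω, (N₀ ω : ℝ≥0∞) ^ β ∂μ :=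
  ((h.identDistrib_N []).comp (u := fun k : ℕ => (k : ℝ≥0∞) ^ β) measurable_from_nat).lintegral_eq

/-- Different children use disjoint blocks of indices. The factor `C [i]` is the root factor of the
i-th subtree, hence belongs to the i-th block. -/
theorem iIndepFun_branch (h : IsInput μ N₀ Q₀ C₀ N Q C) (n : ℕ) :
    iIndepFun (branch N Q C n) μ := by
  have hinj : Function.Injective fun p : (_ : ℕ) × InputIndex => shiftIndex p.1 p.2 := by
    rintro ⟨i, u | u | u⟩ ⟨j, v | v | v⟩ huv <;> simp_all [shiftIndex]
  have h1 := iIndepFun.curry (X := fun i j => inputFamily N Q C (shiftIndex i j))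
    (fun i j => h.measurable_inputFamily _) (h.indep.precomp hinj)
  have h2 := h1.comp (fun _ f => f (Sum.inr (Sum.inr [])) * canonicalPartialWeight n f)
    fun _ => measurable_branchFun n
  convert! h2 using 2 with i
  exact funext fun ω => branch_eq N Q C n _ ω

/-- No shifted index is the index of `N []`, so the branches are functions of the rest of the input
family. -/
theorem indepFun_N_branch (h : IsInput μ N₀ Q₀ C₀ N Q C) (n : ℕ) :
    IndepFun (N []) (fun ω i => branch N Q C n i ω) μ := by
  classical
  have h1 := iIndepFun.indepFun_compl h.measurable_inputFamily h.indep (Sum.inl [])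
  -- The missing coordinate is filled with 0, a value that no branch reads.
  let φ : ({j : InputIndex // j ≠ Sum.inl []} → ℝ≥0) → InputIndex → ℝ≥0 :=
    fun z j => if hj : j ≠ Sum.inl [] then z ⟨j, hj⟩ else 0
  have hφ : Measurable φ := by
    refine measurable_pi_lambda _ fun j => ?_
    by_cases hj : j ≠ Sum.inl []
    · simp only [φ, dif_pos hj]; exact measurable_pi_apply _
    · simp only [φ, dif_neg hj]; exact measurable_const
  have hψ : Measurable fun (f : InputIndex → ℝ≥0) (i : ℕ) =>
      f (shiftIndex i (Sum.inr (Sum.inr []))) *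
        canonicalPartialWeight n fun j => f (shiftIndex i j) :=
    measurable_pi_lambda _ fun i => (measurable_pi_apply _).mul
      ((measurable_canonicalPartialWeight n).comp
        (measurable_pi_lambda _ fun j => measurable_pi_apply _))
  have h2 := h1.comp Nat.measurable_floor (hψ.comp hφ)
  convert! h2 using 1
  · ext1 ω
    simp [inputFamily]
  · ext ω i
    have hne : ∀ j, shiftIndex i j ≠ Sum.inl [] := by
      rintro (u | u | u) <;> simp [shiftIndex]
    simp only [Function.comp, φ, dif_pos (hne _), branch_eq]

end IsInput

theorem IsInput.indepFun_C_partialWeight (h : IsInput μ N₀ Q₀ C₀ N Q C) (n : ℕ) :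
    IndepFun (C []) (partialWeight N Q C n) μ := by
  classical
  set j₀ : InputIndex := Sum.inr (Sum.inr []) with hj₀
  have h1 := iIndepFun.indepFun_compl h.measurable_inputFamily h.indep j₀
  let φ : ({j : InputIndex // j ≠ j₀} → ℝ≥0) → InputIndex → ℝ≥0 :=
    fun z j => if hj : j ≠ j₀ then z ⟨j, hj⟩ else 0
  have hφ : Measurable φ := by
    refine measurable_pi_lambda _ fun j => ?_
    by_cases hj : j ≠ j₀
    · simp only [φ, dif_pos hj]; exact measurable_pi_apply _
    · simp only [φ, dif_neg hj]; exact measurable_const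
  have h2 := h1.comp measurable_id ((measurable_canonicalPartialWeight n).comp hφ)
  convert! h2 using 1
  ext1 ω
  -- Filling the coordinate of `C []` with 0 gives the input family of the same tree with the root
  -- factor replaced by 0, which has the same partial weight.
  have e : (fun j => if j ≠ j₀ then inputFamily N Q C j ω else 0) =
      fun j => inputFamily N Q (fun u ω => if u = [] then 0 else C u ω) j ω := by
    funext j
    rcases j with u | u | u <;> simp [hj₀, inputFamily]
  simp only [Function.comp, φ, dite_eq_ite, e]
  rw [← partialWeight_eq_canonical]
  refine partialWeight_congr fun u hu => ?_
  simp [hu]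

/-- In the subtree of the child 0, `C [0]` is the root factor, hence independent of the partial
weight of that subtree. Working in `ℝ≥0∞` avoids any integrability assumption. -/
theorem IsInput.lintegral_branch_rpow (h : IsInput μ N₀ Q₀ C₀ N Q C) (n : ℕ) (β : ℝ) (hβ : 0 ≤ β) :
    ∫⁻ ω, (branch N Q C n 0 ω : ℝ≥0∞) ^ β ∂μ =
      (∫⁻ ω, (C₀ ω : ℝ≥0∞) ^ β ∂μ) * ∫⁻ ω, (partialWeight N Q C n ω : ℝ≥0∞) ^ β ∂μ := by
  have hm : Measurable fun x : ℝ≥0 => (x : ℝ≥0∞) ^ β := measurable_coe_nnreal_ennreal.pow_const β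
  have e1 := ((h.identDistrib_C [0]).comp hm).lintegral_eq
  have e2 := ((h.identDistrib_partialWeight n 0).comp hm).lintegral_eq
  simp only [Function.comp] at e1 e2
  have e3 := lintegral_mul_eq_lintegral_mul_lintegral_of_indepFun
    (hm.comp (h.measurable_C [0])) (hm.comp ((h.shift 0).measurable_partialWeight n))
    (((h.shift 0).indepFun_C_partialWeight n).comp hm hm)
  simp only [Function.comp] at e3
  rw [← e1, ← e2, ← e3]
  refine lintegral_congr fun ω => ?_
  rw [branch, ENNReal.coe_mul, ENNReal.mul_rpow_of_nonneg _ _ hβ]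
  rfl

theorem IsInput.indepFun_N_coe_branch (h : IsInput μ N₀ Q₀ C₀ N Q C) (n : ℕ) :
    IndepFun (N []) (fun ω i => (branch N Q C n i ω : ℝ≥0∞)) μ :=
  (h.indepFun_N_branch n).comp measurable_id
    (ψ := fun (f : ℕ → ℝ≥0) i => (f i : ℝ≥0∞))
    (measurable_pi_lambda _ fun i => (measurable_pi_apply i).coe_nnreal_ennreal)

end WeightedBranching

/-! ### Moment inequalities -/

/-- The expectation of a function of two independent random variables, as an iterated integral. -/
theorem ProbabilityTheory.IndepFun.lintegral_eq_lintegral {Ω E F : Type*} [MeasurableSpace Ω]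
    [MeasurableSpace E] [MeasurableSpace F] {μ : Measure Ω} [IsProbabilityMeasure μ]
    {U : Ω → E} {V : Ω → F} (h : IndepFun U V μ) (hU : Measurable U) (hV : Measurable V)
    {f : E × F → ℝ≥0∞} (hf : Measurable f) :
    ∫⁻ ω, f (U ω, V ω) ∂μ = ∫⁻ ω, ∫⁻ ω', f (U ω, V ω') ∂μ ∂μ := by
  have := Measure.isProbabilityMeasure_map (μ := μ) hV.aemeasurable
  rw [← lintegral_map hf (hU.prodMk hV),
    (indepFun_iff_map_prod_eq_prod_map_map hU.aemeasurable hV.aemeasurable).1 h,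
    lintegral_prod _ hf.aemeasurable, lintegral_map hf.lintegral_prod_right' hU]
  refine lintegral_congr fun ω => ?_
  exact lintegral_map (hf.comp measurable_prodMk_left) hV

/-- Jensen's inequality for a concave power, from the monotonicity of L^p seminorms on a probability
space. -/
theorem MeasureTheory.lintegral_rpow_le_rpow_lintegral {Ω : Type*} [MeasurableSpace Ω]
    {μ : Measure Ω} [IsProbabilityMeasure μ] {f : Ω → ℝ≥0∞} (hf : Measurable f) {p : ℝ}
    (hp0 : 0 < p) (hp1 : p ≤ 1) : ∫⁻ ω, f ω ^ p ∂μ ≤ (∫⁻ ω, f ω ∂μ) ^ p := by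
  have := eLpNorm'_le_eLpNorm'_of_exponent_le (f := f) hp0 hp1 μ hf.aestronglyMeasurable
  simp only [eLpNorm', enorm_eq_self, ENNReal.rpow_one, one_div, inv_one] at this
  rwa [← ENNReal.rpow_inv_le_iff hp0]

section Moments

variable {Ω : Type*} [MeasurableSpace Ω] {μ : Measure Ω} [IsProbabilityMeasure μ]
  {X : ℕ → Ω → ℝ≥0∞} {β : ℝ}

/-- A moment inequality for sums of independent, identically distributed variables. -/
theorem lintegral_sum_rpow_le (hXm : ∀ i, Measurable (X i)) (hX : iIndepFun X μ)
    (hXi : ∀ i, IdentDistrib (X i) (X 0) μ μ) (hβ1 : 1 < β) (hβ : β ≤ 2) (n : ℕ) :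
    ∫⁻ ω, (∑ i ∈ Finset.range n, X i ω) ^ β ∂μ ≤
      n * ∫⁻ ω, X 0 ω ^ β ∂μ + (n : ℝ≥0∞) ^ β * (∫⁻ ω, X 0 ω ∂μ) ^ β := by
  have hp0 : 0 < β - 1 := by linarith
  have hp1 : β - 1 ≤ 1 := by linarith
  have hsplit : ∀ x : ℝ≥0∞, x ^ β = x * x ^ (β - 1) := fun x => by
    conv_lhs => rw [show β = 1 + (β - 1) by ring,
      ENNReal.rpow_add_of_nonneg _ _ zero_le_one hp0.le, ENNReal.rpow_one]
  set T : ℕ → Ω → ℝ≥0∞ := fun i ω => ∑ j ∈ (Finset.range n).erase i, X j ω with hT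
  have hTm : ∀ i, Measurable (T i) := fun i => Finset.measurable_sum _ fun j _ => hXm j
  -- Write S^β = ∑ X_i S^(β-1) with S = X_i + T_i and use subadditivity of the power β-1 ≤ 1. Then
  -- T_i is independent of X_i, and Jensen's inequality applies to T_i^(β-1).
  have hpt : ∀ ω, (∑ i ∈ Finset.range n, X i ω) ^ β ≤
      ∑ i ∈ Finset.range n, (X i ω ^ β + X i ω * T i ω ^ (β - 1)) := by
    intro ω
    rw [hsplit, Finset.sum_mul]
    refine Finset.sum_le_sum fun i hi => ?_
    rw [hsplit (X i ω), ← mul_add, ← Finset.add_sum_erase _ _ hi]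
    gcongr
    exact ENNReal.rpow_add_le_add_rpow _ _ hp0.le hp1
  have hterm : ∀ i ∈ Finset.range n, ∫⁻ ω, (X i ω ^ β + X i ω * T i ω ^ (β - 1)) ∂μ ≤
      ∫⁻ ω, X 0 ω ^ β ∂μ + (∫⁻ ω, X 0 ω ∂μ) * (n * ∫⁻ ω, X 0 ω ∂μ) ^ (β - 1) := by
    intro i _
    rw [lintegral_add_left ((hXm i).pow_const β)]
    have e1 : ∫⁻ ω, X i ω ^ β ∂μ = ∫⁻ ω, X 0 ω ^ β ∂μ :=
      ((hXi i).comp (u := fun x : ℝ≥0∞ => x ^ β) (measurable_id.pow_const β)).lintegral_eq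
    have hind : IndepFun (X i) (T i) μ := by
      have := (hX.indepFun_finsetSum_of_notMem hXm (Finset.notMem_erase i (Finset.range n))).symm
      convert! this using 1
      ext ω; simp [hT]
    have e2 : ∫⁻ ω, X i ω * T i ω ^ (β - 1) ∂μ =
        (∫⁻ ω, X 0 ω ∂μ) * ∫⁻ ω, T i ω ^ (β - 1) ∂μ := by
      rw [← (hXi i).lintegral_eq]
      exact lintegral_mul_eq_lintegral_mul_lintegral_of_indepFun (hXm i)
        ((hTm i).pow_const _) (hind.comp measurable_id (measurable_id.pow_const (β - 1)))
    have e3 : ∫⁻ ω, T i ω ∂μ ≤ n * ∫⁻ ω, X 0 ω ∂μ := by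
      rw [lintegral_finsetSum _ fun j _ => hXm j]
      simp_rw [fun j => (hXi j).lintegral_eq]
      rw [Finset.sum_const, nsmul_eq_mul]
      gcongr
      simpa using Finset.card_le_card (Finset.erase_subset i (Finset.range n))
    rw [e1, e2]
    gcongr
    exact (lintegral_rpow_le_rpow_lintegral (hTm i) hp0 hp1).trans (by gcongr)
  calc ∫⁻ ω, (∑ i ∈ Finset.range n, X i ω) ^ β ∂μ
      ≤ ∫⁻ ω, ∑ i ∈ Finset.range n, (X i ω ^ β + X i ω * T i ω ^ (β - 1)) ∂μ :=
        lintegral_mono hpt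
    _ = ∑ i ∈ Finset.range n, ∫⁻ ω, (X i ω ^ β + X i ω * T i ω ^ (β - 1)) ∂μ :=
        lintegral_finsetSum _ fun i _ =>
          ((hXm i).pow_const _).add ((hXm i).mul ((hTm i).pow_const _))
    _ ≤ ∑ i ∈ Finset.range n,
          (∫⁻ ω, X 0 ω ^ β ∂μ + (∫⁻ ω, X 0 ω ∂μ) * (n * ∫⁻ ω, X 0 ω ∂μ) ^ (β - 1)) :=
        Finset.sum_le_sum hterm
    _ = _ := by
        rw [Finset.sum_const, Finset.card_range, nsmul_eq_mul, mul_add, ← mul_assoc, ← hsplit,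
          ENNReal.mul_rpow_of_nonneg _ _ (by linarith)]

variable {N : Ω → ℕ}

theorem measurable_sum_range {M : Type*} [AddCommMonoid M] [MeasurableSpace M] [MeasurableAdd₂ M] :
    Measurable fun z : ℕ × (ℕ → M) => ∑ i ∈ Finset.range z.1, z.2 i :=
  measurable_from_prod_countable_right fun n =>
    Finset.measurable_sum (f := fun i (y : ℕ → M) => y i) (Finset.range n) fun i _ =>
      measurable_pi_apply i

/-- Wald's identity, by conditioning on `N`. -/
theorem lintegral_randomSum (hNm : Measurable N) (hXm : ∀ i, Measurable (X i))
    (hNX : IndepFun N (fun ω i => X i ω) μ) (hXi : ∀ i, IdentDistrib (X i) (X 0) μ μ) :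
    ∫⁻ ω, ∑ i ∈ Finset.range (N ω), X i ω ∂μ = (∫⁻ ω, (N ω : ℝ≥0∞) ∂μ) * ∫⁻ ω, X 0 ω ∂μ := by
  have := hNX.lintegral_eq_lintegral hNm (measurable_pi_lambda _ hXm)
    (measurable_sum_range (M := ℝ≥0∞))
  simp only at this
  have hNm' : Measurable fun ω => (N ω : ℝ≥0∞) := measurable_from_nat.comp hNm
  rw [this, ← lintegral_mul_const _ hNm']
  refine lintegral_congr fun ω => ?_
  rw [lintegral_finsetSum _ fun j _ => hXm j]
  simp_rw [fun j => (hXi j).lintegral_eq]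
  simp

theorem lintegral_randomSum_rpow_le (hNm : Measurable N) (hXm : ∀ i, Measurable (X i))
    (hNX : IndepFun N (fun ω i => X i ω) μ) (hX : iIndepFun X μ)
    (hXi : ∀ i, IdentDistrib (X i) (X 0) μ μ) (hβ1 : 1 < β) (hβ : β ≤ 2) :
    ∫⁻ ω, (∑ i ∈ Finset.range (N ω), X i ω) ^ β ∂μ ≤
      (∫⁻ ω, (N ω : ℝ≥0∞) ∂μ) * ∫⁻ ω, X 0 ω ^ β ∂μ +
        (∫⁻ ω, (N ω : ℝ≥0∞) ^ β ∂μ) * (∫⁻ ω, X 0 ω ∂μ) ^ β := by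
  have hNm' : Measurable fun ω => (N ω : ℝ≥0∞) := measurable_from_nat.comp hNm
  have := hNX.lintegral_eq_lintegral hNm (measurable_pi_lambda _ hXm)
    ((measurable_sum_range (M := ℝ≥0∞)).pow_const β)
  simp only at this
  rw [this, ← lintegral_mul_const _ hNm', ← lintegral_mul_const _ (hNm'.pow_const β),
    ← lintegral_add_left (hNm'.mul_const _)]
  exact lintegral_mono fun ω => lintegral_sum_rpow_le hXm hX hXi hβ1 hβ (N ω)

end Moments

namespace WeightedBranching

variable {Ω : Type*} [MeasurableSpace Ω] {μ : Measure Ω} [IsProbabilityMeasure μ]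
  {N₀ : Ω → ℕ} {Q₀ C₀ : Ω → ℝ≥0} {N : List ℕ → Ω → ℕ} {Q C : List ℕ → Ω → ℝ≥0}

namespace IsInput

theorem lintegral_branch (h : IsInput μ N₀ Q₀ C₀ N Q C) (n : ℕ) :
    ∫⁻ ω, (branch N Q C n 0 ω : ℝ≥0∞) ∂μ =
      (∫⁻ ω, (C₀ ω : ℝ≥0∞) ∂μ) * ∫⁻ ω, (partialWeight N Q C n ω : ℝ≥0∞) ∂μ := by
  simpa using h.lintegral_branch_rpow n 1 zero_le_one

theorem lintegral_partialWeight_succ (h : IsInput μ N₀ Q₀ C₀ N Q C) (n : ℕ) :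
    ∫⁻ ω, (partialWeight N Q C (n + 1) ω : ℝ≥0∞) ∂μ = ∫⁻ ω, (Q₀ ω : ℝ≥0∞) ∂μ +
      (∫⁻ ω, (N₀ ω : ℝ≥0∞) ∂μ) * (∫⁻ ω, (C₀ ω : ℝ≥0∞) ∂μ) *
        ∫⁻ ω, (partialWeight N Q C n ω : ℝ≥0∞) ∂μ := by
  have e1 : ∀ ω, (partialWeight N Q C (n + 1) ω : ℝ≥0∞) =
      Q [] ω + ∑ i ∈ Finset.range (N [] ω), (branch N Q C n i ω : ℝ≥0∞) := fun ω => by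
    rw [partialWeight_succ_eq]; push_cast; rfl
  simp_rw [e1]
  have hN := h.lintegral_N (β := 1)
  simp only [ENNReal.rpow_one] at hN
  rw [lintegral_add_left (h.measurable_Q []).coe_nnreal_ennreal,
    lintegral_randomSum (X := fun i ω => (branch N Q C n i ω : ℝ≥0∞)) (h.measurable_N [])
      (fun i => (h.measurable_branch n i).coe_nnreal_ennreal) (h.indepFun_N_coe_branch n)
      (fun i => (h.identDistrib_branch n i).comp measurable_coe_nnreal_ennreal),
    h.lintegral_branch, hN, mul_assoc]
  congr 1
  exact ((h.identDistrib_Q []).comp measurable_coe_nnreal_ennreal).lintegral_eq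

/-- Uniform bound for the moments of order `β` of the partial total weights. -/
theorem exists_lintegral_partialWeight_rpow_le (h : IsInput μ N₀ Q₀ C₀ N Q C) {β : ℝ}
    (hβ1 : 1 < β) (hβ : β ≤ 2) {D : ℝ≥0∞} (hD : D ≠ ∞)
    (hmean : ∀ n, ∫⁻ ω, (branch N Q C n 0 ω : ℝ≥0∞) ∂μ ≤ D)
    (hN : ∫⁻ ω, (N₀ ω : ℝ≥0∞) ^ β ∂μ ≠ ∞) (hQ : ∫⁻ ω, (Q₀ ω : ℝ≥0∞) ^ β ∂μ ≠ ∞)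
    (hρ : (∫⁻ ω, (N₀ ω : ℝ≥0∞) ∂μ) * ∫⁻ ω, (C₀ ω : ℝ≥0∞) ^ β ∂μ < 1) :
    ∃ B : ℝ≥0∞, B ≠ ∞ ∧ ∀ n, ∫⁻ ω, (partialWeight N Q C n ω : ℝ≥0∞) ^ β ∂μ ≤ B := by
  have hβ0 : 0 < β := by linarith
  -- Minkowski's inequality and subadditivity of the power 1/β show that the L^β norms y_n of the
  -- partial weights satisfy y_{n+1} ≤ q + A^(1/β) + r y_n with r < 1. The bound `B` below is the
  -- fixed point of this recursion.
  set q := (∫⁻ ω, (Q₀ ω : ℝ≥0∞) ^ β ∂μ) ^ (1 / β) with hq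
  set A := (∫⁻ ω, (N₀ ω : ℝ≥0∞) ^ β ∂μ) * D ^ β with hA
  set r := ((∫⁻ ω, (N₀ ω : ℝ≥0∞) ∂μ) * ∫⁻ ω, (C₀ ω : ℝ≥0∞) ^ β ∂μ) ^ (1 / β) with hr
  have hr1 : r < 1 := by
    rw [hr]; exact ENNReal.rpow_lt_one hρ (by positivity)
  set K := q + A ^ (1 / β) with hK
  have hKtop : K ≠ ∞ := by
    refine ENNReal.add_ne_top.2 ⟨ENNReal.rpow_ne_top_of_nonneg (by positivity) hQ,
      ENNReal.rpow_ne_top_of_nonneg (by positivity) (ENNReal.mul_ne_top hN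
        (ENNReal.rpow_ne_top_of_nonneg hβ0.le hD))⟩
  have hr0 : 1 - r ≠ 0 := (tsub_pos_of_lt hr1).ne'
  set B := K / (1 - r) with hB
  have hBK : K + r * B = B := by
    have h1 : (1 - r) * B = K := ENNReal.mul_div_cancel hr0 (by simp)
    calc K + r * B = ((1 - r) + r) * B := by rw [add_mul, h1]
      _ = B := by rw [tsub_add_cancel_of_le hr1.le, one_mul]
  have hmain : ∀ n, (∫⁻ ω, (partialWeight N Q C n ω : ℝ≥0∞) ^ β ∂μ) ^ (1 / β) ≤ B := by
    intro n
    induction n with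
    | zero => simp [partialWeight, hβ0]
    | succ n ih =>
      have hSm : Measurable fun ω => ∑ i ∈ Finset.range (N [] ω), (branch N Q C n i ω : ℝ≥0∞) :=
        (measurable_sum_range (M := ℝ≥0∞)).comp ((h.measurable_N []).prodMk
          (measurable_pi_lambda _ fun i => (h.measurable_branch n i).coe_nnreal_ennreal))
      have e1 : ∀ ω, (partialWeight N Q C (n + 1) ω : ℝ≥0∞) =
          ((fun ω => (Q [] ω : ℝ≥0∞)) +
            fun ω => ∑ i ∈ Finset.range (N [] ω), (branch N Q C n i ω : ℝ≥0∞)) ω := fun ω => by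
        rw [partialWeight_succ_eq]; push_cast; rfl
      have hQ' : ∫⁻ ω, (Q [] ω : ℝ≥0∞) ^ β ∂μ = ∫⁻ ω, (Q₀ ω : ℝ≥0∞) ^ β ∂μ :=
        ((h.identDistrib_Q []).comp (u := fun x : ℝ≥0 => (x : ℝ≥0∞) ^ β)
          (measurable_coe_nnreal_ennreal.pow_const β)).lintegral_eq
      have hN1 := h.lintegral_N (β := 1)
      simp only [ENNReal.rpow_one] at hN1
      simp_rw [e1]
      refine (ENNReal.lintegral_Lp_add_le (h.measurable_Q []).coe_nnreal_ennreal.aemeasurable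
        hSm.aemeasurable hβ1.le).trans ?_
      rw [hQ', ← hBK, hK, add_assoc, ← hq]
      gcongr
      have h2 := lintegral_randomSum_rpow_le (μ := μ)
        (X := fun i ω => (branch N Q C n i ω : ℝ≥0∞)) (h.measurable_N [])
        (fun i => (h.measurable_branch n i).coe_nnreal_ennreal) (h.indepFun_N_coe_branch n)
        ((h.iIndepFun_branch n).comp (fun _ x => (x : ℝ≥0∞)) fun _ => measurable_coe_nnreal_ennreal)
        (fun i => (h.identDistrib_branch n i).comp measurable_coe_nnreal_ennreal) hβ1 hβ
      rw [h.lintegral_branch_rpow n β hβ0.le, hN1, h.lintegral_N, ← mul_assoc] at h2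
      calc _ ≤ ((∫⁻ ω, (N₀ ω : ℝ≥0∞) ∂μ) * (∫⁻ ω, (C₀ ω : ℝ≥0∞) ^ β ∂μ) *
            (∫⁻ ω, (partialWeight N Q C n ω : ℝ≥0∞) ^ β ∂μ) + A) ^ (1 / β) := by
            refine ENNReal.rpow_le_rpow (h2.trans ?_) (by positivity)
            rw [hA]
            gcongr
            exact hmean n
        _ ≤ r * (∫⁻ ω, (partialWeight N Q C n ω : ℝ≥0∞) ^ β ∂μ) ^ (1 / β) + A ^ (1 / β) := by
            refine (ENNReal.rpow_add_le_add_rpow _ _ (by positivity) ?_).trans ?_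
            · rw [div_le_one hβ0]; exact hβ1.le
            · rw [ENNReal.mul_rpow_of_nonneg _ _ (by positivity)]
        _ ≤ A ^ (1 / β) + r * B := by
            rw [add_comm]
            gcongr
  refine ⟨B ^ β, ENNReal.rpow_ne_top_of_nonneg hβ0.le (ENNReal.div_ne_top hKtop hr0), fun n => ?_⟩
  have := hmain n
  rwa [one_div, ENNReal.rpow_inv_le_iff hβ0] at this

end IsInput

end WeightedBranching

/-! ### Tails of the iterates of the smoothing recursion -/

theorem setOf_lt_mul_eq {Ω : Type*} {Y : Ω → ℝ} {c x : ℝ} (hc : 0 < c) :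
    {ω | x < c * Y ω} = {ω | x / c < Y ω} := by
  ext ω
  simp only [Set.mem_ofPred_eq]
  rw [div_lt_iff₀ hc, mul_comm]

/-- The iterates `R (n + 1) = Q + ∑_{i < N} X n i` of a smoothing transform: the summands `X n i`
are independent copies of `C * R n`, where `C` and `R n` are independent. -/
structure SmoothingRecursion {Ω : Type*} [MeasurableSpace Ω] (μ : Measure Ω) (N : Ω → ℕ)
    (Q C : Ω → ℝ) (R : ℕ → Ω → ℝ) (X : ℕ → ℕ → Ω → ℝ) : Prop where
  measurable_N : Measurable N
  measurable_C : Measurable C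
  measurable_R : ∀ n, Measurable (R n)
  Q_nonneg : ∀ ω, 0 ≤ Q ω
  C_nonneg : ∀ ω, 0 ≤ C ω
  R_zero : ∀ ω, R 0 ω = 0
  R_succ : ∀ n ω, R (n + 1) ω = Q ω + ∑ i ∈ Finset.range (N ω), X n i ω
  iid : ∀ n, IsIIDNonneg μ (X n)
  indep : ∀ n, IndepFun N (fun ω i => X n i ω) μ
  tail : ∀ n x, μ.real {ω | x < X n 0 ω} = ∫ ω, μ.real {ω' | x < C ω * R n ω'} ∂μ

/-- A variable with a moment of order larger than `α` has a lighter tail than `G`. -/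
theorem RegVarTail.eventually_measureReal_le {α : ℝ} {G : ℝ → ℝ} (hG : RegVarTail α G) (hα : 0 < α)
    {Ω : Type*} [MeasurableSpace Ω] {μ : Measure Ω} [IsProbabilityMeasure μ] {V : Ω → ℝ}
    (hV0 : ∀ ω, 0 ≤ V ω) {p : ℝ} (hp : α < p) (hV : Integrable (fun ω => V ω ^ p) μ)
    {c η : ℝ} (hc : 0 < c) (hη : 0 < η) : ∀ᶠ x in atTop, μ.real {ω | c * x < V ω} ≤ η * G x := by
  have hp0 : 0 < p := hα.trans hp
  filter_upwards [hG.eventually_rpow_le hp hp0 hη ((∫ ω, V ω ^ p ∂μ) / c ^ p),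
    eventually_gt_atTop 0] with x hx hx0
  refine le_trans ?_ hx
  have h1 : (c * x) ^ p * μ.real {ω | c * x < V ω} ≤ ∫ ω, V ω ^ p ∂μ := by
    refine le_trans (mul_le_mul_of_nonneg_left (measureReal_mono fun ω hω => ?_) (by positivity))
      (mul_meas_ge_le_integral_of_nonneg
        (ae_of_all _ fun ω => Real.rpow_nonneg (hV0 ω) p) hV ((c * x) ^ p))
    rw [Set.mem_ofPred_eq] at hω ⊢
    exact Real.rpow_le_rpow (by positivity) hω.le hp0.le
  rw [Real.mul_rpow hc.le hx0.le] at h1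
  rw [Real.rpow_neg hx0.le, ← div_eq_mul_inv, div_div, le_div_iff₀ (by positivity), mul_comm]
  exact h1

namespace SmoothingRecursion

variable {Ω : Type*} [MeasurableSpace Ω] {μ : Measure Ω} [IsProbabilityMeasure μ] {N : Ω → ℕ}
  {Q C : Ω → ℝ} {R : ℕ → Ω → ℝ} {X : ℕ → ℕ → Ω → ℝ} {α : ℝ} {G : ℝ → ℝ}

theorem integrable_tail_div (hs : SmoothingRecursion μ N Q C R X) (hG : RegVarTail α G) (x : ℝ) :
    Integrable (fun ω => if 0 < C ω then G (x / C ω) else 0) μ := by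
  refine Integrable.of_bound (C := 1) (Measurable.aestronglyMeasurable
    (Measurable.ite (measurableSet_lt measurable_const hs.measurable_C)
      (hG.anti.measurable.comp (measurable_const.div hs.measurable_C)) measurable_const))
    (ae_of_all _ fun ω => ?_)
  split_ifs
  · rw [Real.norm_of_nonneg (hG.pos _).le]
    exact hG.le_one _
  · simp

theorem integrable_measureReal_mul (hs : SmoothingRecursion μ N Q C R X) (n : ℕ) (x : ℝ) :
    Integrable (fun ω => μ.real {ω' | x < C ω * R n ω'}) μ := by
  have hB : MeasurableSet {z : ℝ × ℝ | x < z.1 * z.2} :=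
    measurableSet_lt measurable_const (measurable_fst.mul measurable_snd)
  exact integrable_measureReal_section hs.measurable_C (hs.measurable_R n) hB

/-- Conditioning on `C`: where x / C ≥ y₀ the assumed bound applies, and where x / C < y₀ the
probability is bounded by 1, which costs the tail of `C`. Where `C = 0` nothing is contributed, as x
> 0. -/
theorem tail_le (hs : SmoothingRecursion μ N Q C R X) (hG : RegVarTail α G) {n : ℕ} {h y₀ x : ℝ}
    (hh : 0 ≤ h) (hx : 0 < x) (hR : ∀ z, 0 < z → y₀ ≤ z → μ.real {ω | z < R n ω} ≤ h * G z) :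
    μ.real {ω | x < X n 0 ω} ≤
      h * (∫ ω, (if 0 < C ω then G (x / C ω) else 0) ∂μ) + μ.real {ω | x < y₀ * C ω} := by
  have hms : MeasurableSet {ω | x < y₀ * C ω} :=
    measurableSet_lt measurable_const (hs.measurable_C.const_mul _)
  have hi1 := (hs.integrable_tail_div hG x).const_mul h
  have hi2 : Integrable ({ω | x < y₀ * C ω}.indicator (1 : Ω → ℝ)) μ :=
    (integrable_const (1 : ℝ)).indicator hms
  rw [hs.tail, ← integral_const_mul, ← integral_indicator_one hms, ← integral_add hi1 hi2]
  refine integral_mono (hs.integrable_measureReal_mul n x) (hi1.add hi2) fun ω => ?_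
  have hind : 0 ≤ {ω | x < y₀ * C ω}.indicator (1 : Ω → ℝ) ω :=
    Set.indicator_nonneg (fun _ _ => zero_le_one) _
  by_cases hC : 0 < C ω
  · simp only [hC, if_true, setOf_lt_mul_eq hC]
    have hxC : 0 < x / C ω := by positivity
    rcases le_or_gt y₀ (x / C ω) with hy | hy
    · have := hR _ hxC hy
      linarith
    · rw [div_lt_iff₀ hC] at hy
      rw [Set.indicator_of_mem (by exact hy)]
      have := mul_nonneg hh (hG.pos (x / C ω)).le
      have h1 : μ.real {ω' | x / C ω < R n ω'} ≤ 1 := measureReal_le_one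
      simp only [Pi.one_apply]
      linarith
  · have h0 : C ω = 0 := le_antisymm (not_lt.1 hC) (hs.C_nonneg ω)
    simp only [h0, zero_mul, not_lt_of_gt hx, Set.ofPred_false, measureReal_empty, lt_self_iff_false,
      if_false, mul_zero, zero_add]
    exact hind

/-- Conditioning on `C` as in `tail_le`. Where x / C < y₀ the term h·G(x / C) is at most h, and it
is subtracted again. -/
theorem le_tail (hs : SmoothingRecursion μ N Q C R X) (hG : RegVarTail α G) {n : ℕ} {h y₀ x : ℝ}
    (hh : 0 ≤ h) (hx : 0 < x) (hR : ∀ z, y₀ ≤ z → h * G z ≤ μ.real {ω | z < R n ω}) :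
    h * (∫ ω, (if 0 < C ω then G (x / C ω) else 0) ∂μ) - h * μ.real {ω | x < y₀ * C ω} ≤
      μ.real {ω | x < X n 0 ω} := by
  have hms : MeasurableSet {ω | x < y₀ * C ω} :=
    measurableSet_lt measurable_const (hs.measurable_C.const_mul _)
  have hi1 := (hs.integrable_tail_div hG x).const_mul h
  have hi2 : Integrable ({ω | x < y₀ * C ω}.indicator (1 : Ω → ℝ)) μ :=
    (integrable_const (1 : ℝ)).indicator hms
  have hi3 := hi2.const_mul h
  rw [hs.tail, ← integral_const_mul, ← integral_indicator_one hms, ← integral_const_mul,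
    ← integral_sub hi1 hi3]
  refine integral_mono (hi1.sub hi3) (hs.integrable_measureReal_mul n x) fun ω => ?_
  have hind : 0 ≤ h * {ω | x < y₀ * C ω}.indicator (1 : Ω → ℝ) ω :=
    mul_nonneg hh (Set.indicator_nonneg (fun _ _ => zero_le_one) _)
  by_cases hC : 0 < C ω
  · simp only [hC, if_true, setOf_lt_mul_eq hC]
    rcases le_or_gt y₀ (x / C ω) with hy | hy
    · have := hR _ hy
      linarith
    · rw [div_lt_iff₀ hC] at hy
      rw [Set.indicator_of_mem (by exact hy)]
      have := mul_le_mul_of_nonneg_left (hG.le_one (x / C ω)) hh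
      have h1 : 0 ≤ μ.real {ω' | x / C ω < R n ω'} := measureReal_nonneg
      simp only [Pi.one_apply]
      linarith
  · have h0 : C ω = 0 := le_antisymm (not_lt.1 hC) (hs.C_nonneg ω)
    simp only [h0, zero_mul, not_lt_of_gt hx, Set.ofPred_false, measureReal_empty, lt_self_iff_false,
      if_false, mul_zero, zero_sub]
    linarith

/-- Breiman's lemma at the level sx, combined with G(sx) / G(x) → s^(-α). -/
theorem eventually_tail_div_le (hs : SmoothingRecursion μ N Q C R X) (hG : RegVarTail α G)
    (hα : 0 < α) {p : ℝ} (hp : α < p) (hCp : Integrable (fun ω => C ω ^ p) μ) {a s c : ℝ}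
    (hs0 : 0 < s) (hc : a * ((∫ ω, C ω ^ α ∂μ) * s ^ (-α)) < c) :
    ∀ᶠ x in atTop, a * (∫ ω, (if 0 < C ω then G (s * x / C ω) else 0) ∂μ) ≤ c * G x := by
  have h1 := (hG.tendsto_integral_div hα hs.measurable_C hs.C_nonneg hp hCp).comp
    (tendsto_id.const_mul_atTop hs0)
  have h2 := ((h1.mul (hG.tendsto_ratio s hs0)).const_mul a).eventually_lt_const hc
  filter_upwards [h2] with x hx
  have hG1 := (hG.pos (s * x)).ne'
  have hG2 := hG.pos x
  simp only [Function.comp, id] at hx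
  rw [div_mul_div_cancel₀ hG1, ← mul_div_assoc, div_lt_iff₀ hG2] at hx
  exact hx.le

theorem eventually_le_tail_div (hs : SmoothingRecursion μ N Q C R X) (hG : RegVarTail α G)
    (hα : 0 < α) {p : ℝ} (hp : α < p) (hCp : Integrable (fun ω => C ω ^ p) μ) {a c : ℝ}
    (hc : c < a * ∫ ω, C ω ^ α ∂μ) :
    ∀ᶠ x in atTop, c * G x ≤ a * ∫ ω, (if 0 < C ω then G (x / C ω) else 0) ∂μ := by
  have h1 := hG.tendsto_integral_div hα hs.measurable_C hs.C_nonneg hp hCp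
  filter_upwards [(h1.const_mul a).eventually_const_lt hc] with x hx
  rw [← mul_div_assoc, lt_div_iff₀ (hG.pos x)] at hx
  exact hx.le

/-- The error term of `tail_le` and `le_tail` is negligible, because `C` has a moment of order
larger than α. -/
theorem eventually_measureReal_mul_le (hs : SmoothingRecursion μ N Q C R X) (hG : RegVarTail α G)
    (hα : 0 < α) {p : ℝ} (hp : α < p) (hCp : Integrable (fun ω => C ω ^ p) μ) {a s y₀ c : ℝ}
    (ha : 0 ≤ a) (hs0 : 0 < s) (hy : 0 ≤ y₀) (hc : 0 < c) :
    ∀ᶠ x in atTop, a * μ.real {ω | s * x < y₀ * C ω} ≤ c * G x := by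
  rcases hy.eq_or_lt with rfl | hy
  · filter_upwards [eventually_gt_atTop 0] with x hx
    have : 0 < s * x := by positivity
    simp only [zero_mul, not_lt_of_gt this, Set.ofPred_false, measureReal_empty, mul_zero]
    exact (mul_pos hc (hG.pos x)).le
  · filter_upwards [hG.eventually_measureReal_le hα hs.C_nonneg hp hCp (c := s / y₀)
      (η := c / (a + 1)) (by positivity) (by positivity)] with x hx
    have e : {ω | s * x < y₀ * C ω} = {ω | s / y₀ * x < C ω} := by
      rw [setOf_lt_mul_eq hy, mul_div_right_comm]
    rw [e]
    calc a * μ.real {ω | s / y₀ * x < C ω} ≤ (a + 1) * (c / (a + 1) * G x) := by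
          gcongr; linarith
      _ = c * G x := by field_simp

/-- Both left-hand sides converge, to `m₀ ^ α` and `ρ`, as ε → 0. The bound `m₀ + ε` on the mean
stays positive even if `m₀ = 0`, as `exists_randomSum_le` requires. -/
theorem exists_small_parameter (hα : 0 < α) {m₀ ρ δ : ℝ} (hm₀ : 0 ≤ m₀) (hδ : 0 < δ) :
    ∃ ε, 0 < ε ∧ ε < 1 / 2 ∧ ((1 - 2 * ε) / (m₀ + ε)) ^ (-α) < m₀ ^ α + δ ∧
      ρ * (1 - 2 * ε) ^ (-α) < ρ + δ := by
  have h1 : Tendsto (fun ε : ℝ => ((m₀ + ε) / (1 - 2 * ε)) ^ α) (𝓝 0)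
      (𝓝 (((m₀ + 0) / (1 - 2 * 0)) ^ α)) :=
    ((tendsto_const_nhds.add tendsto_id).div
      (tendsto_const_nhds.sub (tendsto_id.const_mul 2)) (by norm_num)).rpow_const (Or.inr hα.le)
  have h2 : Tendsto (fun ε : ℝ => ρ * (1 - 2 * ε) ^ (-α)) (𝓝 0)
      (𝓝 (ρ * (1 - 2 * 0) ^ (-α))) :=
    ((tendsto_const_nhds.sub (tendsto_id.const_mul 2)).rpow_const
      (Or.inl (by norm_num))).const_mul ρ
  have h3 : ∀ᶠ ε : ℝ in 𝓝[>] 0, 0 < ε ∧ ε < 1 / 2 := Ioo_mem_nhdsGT (by norm_num)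
  obtain ⟨ε, ⟨ha, hb⟩, hc, hd⟩ := (h3.and
    (((h1.mono_left nhdsWithin_le_nhds).eventually_lt_const (u := m₀ ^ α + δ) (by simpa using hδ)).and
    ((h2.mono_left nhdsWithin_le_nhds).eventually_lt_const (u := ρ + δ) (by simpa using hδ)))).exists
  refine ⟨ε, ha, hb, ?_, hd⟩
  have h5 : 0 < 1 - 2 * ε := by linarith
  have h6 : 0 < m₀ + ε := by linarith
  rwa [Real.rpow_neg (by positivity), ← Real.inv_rpow (by positivity), inv_div]

/-- Improving an upper bound for the tails of all iterates. -/
theorem eventually_succ_le (hs : SmoothingRecursion μ N Q C R X) (hG : RegVarTail α G)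
    (hα : 0 < α) {p : ℝ} (hp : α < p) (hCp : Integrable (fun ω => C ω ^ p) μ)
    (hQp : Integrable (fun ω => Q ω ^ p) μ) (hNi : Integrable (fun ω => (N ω : ℝ)) μ)
    (hN : ∀ x, 0 < x → μ.real {ω | x < (N ω : ℝ)} = G x) {β M m₀ : ℝ} (hβ1 : 1 < β) (hβ : β ≤ 2)
    (hm : ∀ n, ∫ ω, X n 0 ω ∂μ ≤ m₀) (hXi : ∀ n, Integrable (fun ω => X n 0 ω ^ β) μ)
    (hM : ∀ n, ∫ ω, X n 0 ω ^ β ∂μ ≤ M) {δ y₀ : ℝ} (hδ : 0 < δ) (hy₀ : 0 ≤ y₀) :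
    ∀ᶠ x in atTop, ∀ n, ∀ h, 0 ≤ h →
      (∀ z, 0 < z → y₀ ≤ z → μ.real {ω | z < R n ω} ≤ h * G z) →
      μ.real {ω | x < R (n + 1) ω} ≤
        (m₀ ^ α + δ + ((∫ ω, (N ω : ℝ) ∂μ) * (∫ ω, C ω ^ α ∂μ) + δ) * h) * G x := by
  set ν := ∫ ω, (N ω : ℝ) ∂μ with hν
  set κ := ∫ ω, C ω ^ α ∂μ with hκ
  have hν0 : 0 ≤ ν := integral_nonneg fun ω => by positivity
  have hκ0 : 0 ≤ κ := integral_nonneg fun ω => Real.rpow_nonneg (hs.C_nonneg ω) _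
  have hm₀ : 0 ≤ m₀ := (integral_nonneg ((hs.iid 0).nonneg 0)).trans (hm 0)
  obtain ⟨ε, hε0, hε2, hε3, hε4⟩ := exists_small_parameter hα (ρ := ν * κ) hm₀
    (show 0 < δ / 4 by positivity)
  have hs0 : 0 < 1 - 2 * ε := by linarith
  have hmε : 0 < m₀ + ε := by linarith
  obtain ⟨γ, hγ, hγ2⟩ := IsIIDNonneg.exists_randomSum_le hG hα hs.measurable_N hNi hN
    (fun c hc η hη => hG.eventually_measureReal_le hα hs.Q_nonneg hp hQp hc hη) hβ1 hβ hmε M hε0 hε2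
  -- At level γx a summand has a tail of about κγ^(-α)h·G(x), so this η keeps its contribution below
  -- (δ/2)h·G(x). Since γ is fixed before η, there is no circularity.
  set η := δ / 4 / (κ * γ ^ (-α) + 1) with hη
  have hγα : 0 < γ ^ (-α) := by positivity
  have hη0 : 0 < η := by positivity
  have hηle : η ≤ δ / 4 := div_le_self (by positivity) (by nlinarith [mul_nonneg hκ0 hγα.le])
  have hηlt : η * (κ * γ ^ (-α)) < δ / 2 := by
    have : η * (κ * γ ^ (-α) + 1) = δ / 4 := by rw [hη]; field_simp
    nlinarith
  filter_upwards [hγ2 η hη0, hG.eventually_le_mul (t := (1 - 2 * ε) / (m₀ + ε)) (by positivity) hε3,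
    hs.eventually_tail_div_le hG hα hp hCp (a := ν) (c := ν * κ + δ / 4) hs0
      (by rw [← mul_assoc]; exact hε4),
    hs.eventually_tail_div_le hG hα hp hCp (a := η) (c := δ / 2) hγ hηlt,
    hs.eventually_measureReal_mul_le hG hα hp hCp hν0 hs0 hy₀ (show 0 < δ / 4 by positivity),
    hs.eventually_measureReal_mul_le hG hα hp hCp hη0.le hγ hy₀ (show 0 < δ / 4 by positivity),
    eventually_gt_atTop 0] with x h1 h2 h3 h4 h5 h6 hx0
  intro n h hh hR
  have hGx := hG.pos x
  have t0 := h1 (X n) (hs.iid n) (hs.indep n) ((hm n).trans (by linarith)) (hXi n) (hM n)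
  have t1 := mul_le_mul_of_nonneg_left
    (hs.tail_le hG hh (mul_pos hs0 hx0) hR) hν0
  have t2 := mul_le_mul_of_nonneg_left (hs.tail_le hG hh (mul_pos hγ hx0) hR) hη0.le
  have t3 := mul_le_mul_of_nonneg_left h3 hh
  have t4 := mul_le_mul_of_nonneg_left h4 hh
  have t5 : η * G x ≤ δ / 4 * G x := by gcongr
  have t6 : 0 ≤ δ * h * G x := by positivity
  simp_rw [hs.R_succ]
  nlinarith

/-- The tails of all iterates are uniformly dominated. -/
theorem exists_uniform_bound (hs : SmoothingRecursion μ N Q C R X) (hG : RegVarTail α G)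
    {a b : ℝ} (hb : b < 1)
    (hstep : ∀ᶠ x in atTop, ∀ n, ∀ h, 0 ≤ h →
      (∀ z, 0 < z → 0 ≤ z → μ.real {ω | z < R n ω} ≤ h * G z) →
      μ.real {ω | x < R (n + 1) ω} ≤ (a + b * h) * G x) :
    ∃ K, 0 ≤ K ∧ ∀ n z, 0 < z → μ.real {ω | z < R n ω} ≤ K * G z := by
  obtain ⟨x₁, hx₁⟩ := eventually_atTop.1 hstep
  have hG1 := hG.pos x₁
  -- The first term covers z < x₁, where `K * G z ≥ 1`; the second gives a + bK ≤ K. As x₁ does not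
  -- depend on n, induction from `R 0 = 0` keeps the same `K`.
  set K := max (1 / G x₁) (a / (1 - b)) with hK
  have hK0 : 0 ≤ K := (by positivity : 0 ≤ 1 / G x₁).trans (le_max_left _ _)
  refine ⟨K, hK0, fun n => ?_⟩
  induction n with
  | zero =>
    intro z hz
    have : {ω | z < R 0 ω} = ∅ := by
      ext ω; simp [hs.R_zero, hz.le]
    rw [this, measureReal_empty]
    exact mul_nonneg hK0 (hG.pos z).le
  | succ n ih =>
    intro z hz
    rcases le_or_gt x₁ z with h | h
    · refine (hx₁ z h n K hK0 fun z hz _ => ih z hz).trans ?_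
      have h1 : a / (1 - b) ≤ K := le_max_right _ _
      rw [div_le_iff₀ (by linarith)] at h1
      refine mul_le_mul_of_nonneg_right ?_ (hG.pos z).le
      linarith
    · refine measureReal_le_one.trans ?_
      have h1 : 1 / G x₁ ≤ K := le_max_left _ _
      rw [div_le_iff₀ hG1] at h1
      refine h1.trans (mul_le_mul_of_nonneg_left (hG.anti h.le) hK0)

/-- Asymptotic upper bound for the tails of all iterates. -/
theorem eventually_forall_le (hs : SmoothingRecursion μ N Q C R X) (hG : RegVarTail α G)
    (hα : 0 < α) {p : ℝ} (hp : α < p) (hCp : Integrable (fun ω => C ω ^ p) μ)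
    (hQp : Integrable (fun ω => Q ω ^ p) μ) (hNi : Integrable (fun ω => (N ω : ℝ)) μ)
    (hN : ∀ x, 0 < x → μ.real {ω | x < (N ω : ℝ)} = G x) {β M m₀ : ℝ} (hβ1 : 1 < β) (hβ : β ≤ 2)
    (hm : ∀ n, ∫ ω, X n 0 ω ∂μ ≤ m₀) (hXi : ∀ n, Integrable (fun ω => X n 0 ω ^ β) μ)
    (hM : ∀ n, ∫ ω, X n 0 ω ^ β ∂μ ≤ M) {ρ : ℝ}
    (hρ : ρ = (∫ ω, (N ω : ℝ) ∂μ) * ∫ ω, C ω ^ α ∂μ) (hρ1 : ρ < 1) {h : ℝ}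
    (hh : m₀ ^ α / (1 - ρ) < h) :
    ∀ᶠ x in atTop, ∀ n, μ.real {ω | x < R n ω} ≤ h * G x := by
  have hρ0 : 0 ≤ ρ := by
    rw [hρ]
    exact mul_nonneg (integral_nonneg fun ω => by positivity)
      (integral_nonneg fun ω => Real.rpow_nonneg (hs.C_nonneg ω) _)
  have hm₀ : 0 ≤ m₀ := (integral_nonneg ((hs.iid 0).nonneg 0)).trans (hm 0)
  have hlim : Tendsto (fun δ : ℝ => (m₀ ^ α + δ) / (1 - (ρ + δ))) (𝓝[>] 0)
      (𝓝 ((m₀ ^ α + 0) / (1 - (ρ + 0)))) :=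
    (((tendsto_const_nhds.add tendsto_id).div
      (tendsto_const_nhds.sub (tendsto_const_nhds.add tendsto_id)) (by linarith)).mono_left
      nhdsWithin_le_nhds)
  simp only [add_zero] at hlim
  -- δ is so small that the fixed point of the perturbed map h ↦ a + bh is still below `h`.
  obtain ⟨δ, hδh, hδ0, hδ1⟩ := ((hlim.eventually_lt_const hh).and
    (Ioo_mem_nhdsGT (show (0 : ℝ) < 1 - ρ by linarith))).exists
  set a := m₀ ^ α + δ with ha
  set b := ρ + δ with hb
  have ha0 : 0 ≤ a := by positivity
  have hb0 : 0 ≤ b := by positivity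
  have hb1 : b < 1 := by linarith
  have hstep : ∀ y₀, 0 ≤ y₀ → ∀ᶠ x in atTop, ∀ n, ∀ h, 0 ≤ h →
      (∀ z, 0 < z → y₀ ≤ z → μ.real {ω | z < R n ω} ≤ h * G z) →
      μ.real {ω | x < R (n + 1) ω} ≤ (a + b * h) * G x := fun y₀ hy₀ => by
    have := hs.eventually_succ_le hG hα hp hCp hQp hNi hN hβ1 hβ hm hXi hM hδ0 hy₀
    rwa [← hρ] at this
  obtain ⟨K, hK0, hK⟩ := hs.exists_uniform_bound hG hb1 (hstep 0 le_rfl)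
  set l := a / (1 - b) with hl
  have hl0 : 0 ≤ l := div_nonneg ha0 (by linarith)
  have hlab : a + b * l = l := by
    have : 1 - b ≠ 0 := by linarith
    rw [hl]; field_simp; ring
  -- Each application of the recursion shrinks the excess over the fixed point `l` by the factor b,
  -- at the cost of a new threshold. The number j of applications depends on `h` only, so the final
  -- threshold serves all n.
  have hiter : ∀ j : ℕ, ∃ y₀, 0 ≤ y₀ ∧ ∀ n z, 0 < z → y₀ ≤ z →
      μ.real {ω | z < R n ω} ≤ (l + b ^ j * K) * G z := by
    intro j
    induction j with
    | zero =>
      refine ⟨0, le_rfl, fun n z hz _ => (hK n z hz).trans ?_⟩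
      refine mul_le_mul_of_nonneg_right ?_ (hG.pos z).le
      rw [pow_zero, one_mul]; linarith
    | succ j ih =>
      obtain ⟨y₀, hy₀, hy⟩ := ih
      obtain ⟨y₁, hy₁⟩ := eventually_atTop.1 (hstep y₀ hy₀)
      refine ⟨max y₁ 0, le_max_right _ _, fun n z hz hyz => ?_⟩
      have hpos : 0 ≤ l + b ^ (j + 1) * K := by positivity
      rcases n with _ | n
      · have : {ω | z < R 0 ω} = ∅ := by
          ext ω; simp [hs.R_zero, hz.le]
        rw [this, measureReal_empty]
        exact mul_nonneg hpos (hG.pos z).le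
      · refine (hy₁ z ((le_max_left _ _).trans hyz) n (l + b ^ j * K) (by positivity)
          (hy n)).trans (le_of_eq ?_)
        rw [pow_succ]
        linear_combination G z * hlab
  have hpow : Tendsto (fun j : ℕ => l + b ^ j * K) atTop (𝓝 (l + 0 * K)) :=
    tendsto_const_nhds.add ((tendsto_pow_atTop_nhds_zero_of_lt_one hb0 hb1).mul_const K)
  rw [zero_mul, add_zero] at hpow
  obtain ⟨j, hj⟩ := (hpow.eventually_lt_const hδh).exists
  obtain ⟨y₀, hy₀, hy⟩ := hiter j
  filter_upwards [eventually_ge_atTop y₀, eventually_gt_atTop 0] with x hx hx0 n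
  exact (hy n x hx0 hx).trans (mul_le_mul_of_nonneg_right hj.le (hG.pos x).le)

/-- Parameters for the contribution of a large number of summands. -/
theorem exists_law_parameter (hα : 0 < α) {Y : ℕ → Ω → ℝ} (hY : IsIIDNonneg μ Y) {δ : ℝ}
    (hδ : 0 < δ) : ∃ b > 0, ∃ c ≥ 0, (∫ ω, Y 0 ω ∂μ) ^ α - δ < c * b ^ (-α) ∧
      ∀ᶠ n : ℕ in atTop, c ≤ μ.real {ω | n / b < ∑ i ∈ Finset.range n, Y i ω} := by
  set m := ∫ ω, Y 0 ω ∂μ with hm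
  have hm0 : 0 ≤ m := integral_nonneg (hY.nonneg 0)
  rcases hm0.eq_or_lt with h0 | h0
  -- If the mean is zero, nothing has to be gained from many summands, and c = 0 works.
  · refine ⟨1, one_pos, 0, le_rfl, ?_, Eventually.of_forall fun n => measureReal_nonneg⟩
    rw [← h0, Real.zero_rpow hα.ne']
    linarith
  · have hlim : Tendsto (fun η : ℝ => (1 - η) * (m / (1 + η)) ^ α) (𝓝[>] 0)
        (𝓝 ((1 - 0) * (m / (1 + 0)) ^ α)) :=
      ((tendsto_const_nhds.sub tendsto_id).mul ((tendsto_const_nhds.div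
        (tendsto_const_nhds.add tendsto_id) (by norm_num)).rpow_const
          (Or.inr hα.le))).mono_left nhdsWithin_le_nhds
    obtain ⟨η, h1, h2, h3⟩ := ((hlim.eventually_const_lt
      (u := m ^ α - δ) (by simpa using hδ)).and
      (Ioo_mem_nhdsGT (zero_lt_one' ℝ))).exists
    -- A slope slightly below the mean, so that by the weak law the sum exceeds n / b with
    -- probability at least 1 - η for large n.
    refine ⟨(1 + η) / m, by positivity, 1 - η, by linarith, ?_, ?_⟩
    · rwa [Real.rpow_neg (by positivity), ← Real.inv_rpow (by positivity), inv_div]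
    · have hlt : m / (1 + η) < ∫ ω, Y 0 ω ∂μ := by
        rw [← hm, div_lt_iff₀ (by linarith)]
        nlinarith
      filter_upwards [IsIIDNonneg.eventually_le_measureReal_sum hY hlt h2] with n hn
      rwa [div_div_eq_mul_div, mul_div_assoc]

/-- Improving a lower bound for the tail of an iterate. -/
theorem eventually_le_succ (hs : SmoothingRecursion μ N Q C R X) (hG : RegVarTail α G)
    (hα : 0 < α) {p : ℝ} (hp : α < p) (hCp : Integrable (fun ω => C ω ^ p) μ)
    (hNi : Integrable (fun ω => (N ω : ℝ)) μ) (hN0 : 0 < ∫ ω, (N ω : ℝ) ∂μ)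
    (hN : ∀ x, 0 < x → μ.real {ω | x < (N ω : ℝ)} = G x) (n : ℕ) {δ h : ℝ} (hδ : 0 < δ)
    (hh : 0 ≤ h) (hR : ∀ᶠ z in atTop, h * G z ≤ μ.real {ω | z < R n ω}) :
    ∀ᶠ x in atTop, ((∫ ω, X n 0 ω ∂μ) ^ α +
      (∫ ω, (N ω : ℝ) ∂μ) * (∫ ω, C ω ^ α ∂μ) * h - δ) * G x ≤ μ.real {ω | x < R (n + 1) ω} := by
  set ν := ∫ ω, (N ω : ℝ) ∂μ with hν
  set κ := ∫ ω, C ω ^ α ∂μ with hκ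
  set m := ∫ ω, X n 0 ω ∂μ with hm
  have hκ0 : 0 ≤ κ := integral_nonneg fun ω => Real.rpow_nonneg (hs.C_nonneg ω) _
  obtain ⟨b, hb, c, hc, hbc, hlaw⟩ := exists_law_parameter hα (hs.iid n)
    (show 0 < δ / 3 by positivity)
  obtain ⟨y₁, hy₁⟩ := eventually_atTop.1 hR
  set y₀ := max y₁ 0 with hy₀
  -- The minimum with ν keeps ν - d nonnegative. The other term makes the loss d·hκ less than δ/3,
  -- one of three such losses.
  set d := min ν (δ / 3 / (h * κ + 1)) with hd
  have hhκ : 0 ≤ h * κ := mul_nonneg hh hκ0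
  have hd0 : 0 < d := lt_min hN0 (by positivity)
  have hdν : d ≤ ν := min_le_left _ _
  have hdκ : d * (h * κ) < δ / 3 := by
    have h1 : d * (h * κ + 1) ≤ δ / 3 := by
      have := min_le_right ν (δ / 3 / (h * κ + 1))
      rwa [le_div_iff₀ (by positivity)] at this
    nlinarith
  have hlim1 : ∀ᶠ x in atTop, (m ^ α - δ / 3) * G x ≤ c * G (b * x) := by
    have := (hG.tendsto_ratio b hb).const_mul c
    filter_upwards [this.eventually_const_lt hbc] with x hx
    rw [← mul_div_assoc, lt_div_iff₀ (hG.pos x)] at hx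
    exact hx.le
  filter_upwards [hlim1, hs.eventually_le_tail_div hG hα hp hCp (a := (ν - d) * h)
      (c := ν * κ * h - δ / 3) (by nlinarith),
    hs.eventually_measureReal_mul_le hG hα hp hCp (a := ν * h) (y₀ := y₀) (by positivity) one_pos
      (le_max_right _ _) (show 0 < δ / 3 by positivity),
    IsIIDNonneg.eventually_le_randomSum hs.measurable_N hNi hN hs.Q_nonneg (hs.iid n) (hs.indep n)
      hb hc hd0 hlaw, eventually_gt_atTop 0] with x h1 h2 h3 h4 hx0
  simp_rw [hs.R_succ]
  rw [one_mul] at h3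
  have t1 := mul_le_mul_of_nonneg_left (hs.le_tail hG (y₀ := y₀) hh hx0
    fun z hz => hy₁ z ((le_max_left _ _).trans hz)) (show 0 ≤ ν - d by linarith)
  have t2 : (ν - d) * (h * μ.real {ω | x < y₀ * C ω}) ≤ ν * h * μ.real {ω | x < y₀ * C ω} := by
    rw [mul_assoc]
    have : 0 ≤ h * μ.real {ω | x < y₀ * C ω} := by positivity
    gcongr
    linarith
  have t3 : (m ^ α + ν * κ * h - δ) * G x = (m ^ α - δ / 3) * G x +
      (ν * κ * h - δ / 3) * G x - δ / 3 * G x := by ring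
  rw [t3]
  rw [mul_sub] at t1
  linarith

/-- Asymptotic lower bound for the tails of the iterates. -/
theorem exists_eventually_le (hs : SmoothingRecursion μ N Q C R X) (hG : RegVarTail α G)
    (hα : 0 < α) {p : ℝ} (hp : α < p) (hCp : Integrable (fun ω => C ω ^ p) μ)
    (hNi : Integrable (fun ω => (N ω : ℝ)) μ) (hN0 : 0 < ∫ ω, (N ω : ℝ) ∂μ)
    (hN : ∀ x, 0 < x → μ.real {ω | x < (N ω : ℝ)} = G x) {m₀ ρ : ℝ}
    (hm : Tendsto (fun n => ∫ ω, X n 0 ω ∂μ) atTop (𝓝 m₀))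
    (hρ : ρ = (∫ ω, (N ω : ℝ) ∂μ) * ∫ ω, C ω ^ α ∂μ) (hρ1 : ρ < 1) {h : ℝ}
    (hh : h < m₀ ^ α / (1 - ρ)) :
    ∃ n, ∀ᶠ x in atTop, h * G x ≤ μ.real {ω | x < R n ω} := by
  have hρ0 : 0 ≤ ρ := by
    rw [hρ]
    exact mul_nonneg hN0.le (integral_nonneg fun ω => Real.rpow_nonneg (hs.C_nonneg ω) _)
  have hm0 : ∀ n, 0 ≤ ∫ ω, X n 0 ω ∂μ := fun n => integral_nonneg ((hs.iid n).nonneg 0)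
  -- For h₁ strictly below the fixed point, h₁(1-ρ) < m₀^α, so (E[X_{n,0}])^α ≥ h₁(1-ρ) from some n₀
  -- on. From there the deficit from h₁ shrinks by the factor ρ at each step, up to δ; at k = 0 the
  -- claimed constant is negative.
  obtain ⟨h₁, hh1, hh2⟩ := exists_between hh
  rw [lt_div_iff₀ (by linarith)] at hh2
  have hma := hm.rpow_const (p := α) (Or.inr hα.le)
  obtain ⟨n₀, hn₀⟩ := eventually_atTop.1 (hma.eventually_const_le hh2)
  -- the lower bounds that the recursion produces
  have key : ∀ k : ℕ, ∀ δ > 0, ∀ᶠ x in atTop,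
      (h₁ - ρ ^ k * |h₁| - δ) * G x ≤ μ.real {ω | x < R (n₀ + k) ω} := by
    intro k
    induction k with
    | zero =>
      intro δ hδ
      refine Eventually.of_forall fun x => le_trans ?_ measureReal_nonneg
      refine mul_nonpos_of_nonpos_of_nonneg ?_ (hG.pos x).le
      have := le_abs_self h₁
      simp only [pow_zero, one_mul]
      linarith
    | succ k ih =>
      intro δ hδ
      -- `eventually_le_succ` needs a nonnegative constant, and 0 is always a lower bound.
      set g := max (h₁ - ρ ^ k * |h₁| - δ / 2) 0 with hg
      have hIH : ∀ᶠ z in atTop, g * G z ≤ μ.real {ω | z < R (n₀ + k) ω} := by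
        filter_upwards [ih (δ / 2) (half_pos hδ)] with z hz
        rcases max_choice (h₁ - ρ ^ k * |h₁| - δ / 2) 0 with hc | hc
        · rwa [hg, hc]
        · rw [hg, hc, zero_mul]
          exact measureReal_nonneg
      have := hs.eventually_le_succ hG hα hp hCp hNi hN0 hN (n₀ + k) (half_pos hδ)
        (le_max_right _ _) hIH
      filter_upwards [this] with x hx
      rw [← hρ] at hx
      refine le_trans (mul_le_mul_of_nonneg_right ?_ (hG.pos x).le) hx
      have h1 := hn₀ (n₀ + k) (Nat.le_add_right _ _)
      have h2 : ρ * (h₁ - ρ ^ k * |h₁| - δ / 2) ≤ ρ * g :=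
        mul_le_mul_of_nonneg_left (le_max_left _ _) hρ0
      rw [pow_succ]
      nlinarith
  have hpow : Tendsto (fun k : ℕ => ρ ^ k * |h₁|) atTop (𝓝 (0 * |h₁|)) :=
    (tendsto_pow_atTop_nhds_zero_of_lt_one hρ0 hρ1).mul_const _
  rw [zero_mul] at hpow
  obtain ⟨k, hk⟩ := (hpow.eventually_lt_const (show 0 < (h₁ - h) / 2 by linarith)).exists
  refine ⟨n₀ + k, ?_⟩
  filter_upwards [key k ((h₁ - h) / 2) (by linarith)] with x hx
  refine le_trans (mul_le_mul_of_nonneg_right ?_ (hG.pos x).le) hx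
  linarith

end SmoothingRecursion

/-! ### Moments of variables with values in `ℝ≥0` -/

section NNRealMoments

variable {Ω : Type*} [MeasurableSpace Ω] {μ : Measure Ω} {f : Ω → ℝ≥0} {q : ℝ}

theorem lintegral_coe_rpow_eq_ofReal (hq : 0 ≤ q) (hf : Integrable (fun ω => (f ω : ℝ) ^ q) μ) :
    ∫⁻ ω, (f ω : ℝ≥0∞) ^ q ∂μ = ENNReal.ofReal (∫ ω, (f ω : ℝ) ^ q ∂μ) := by
  rw [ofReal_integral_eq_lintegral_ofReal hf (ae_of_all _ fun ω => by positivity)]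
  refine lintegral_congr fun ω => ?_
  rw [← ENNReal.ofReal_rpow_of_nonneg (f ω).coe_nonneg hq, ENNReal.ofReal_coe_nnreal]

theorem lintegral_coe_eq_ofReal (hf : Integrable (fun ω => (f ω : ℝ)) μ) :
    ∫⁻ ω, (f ω : ℝ≥0∞) ∂μ = ENNReal.ofReal (∫ ω, (f ω : ℝ) ∂μ) := by
  simpa using lintegral_coe_rpow_eq_ofReal (q := 1) zero_le_one (by simpa using hf)

theorem integrable_coe_rpow_of_lintegral_le (hfm : Measurable f) (hq : 0 ≤ q) {B : ℝ≥0∞}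
    (hB : B ≠ ∞) (h : ∫⁻ ω, (f ω : ℝ≥0∞) ^ q ∂μ ≤ B) :
    Integrable (fun ω => (f ω : ℝ) ^ q) μ ∧ ∫ ω, (f ω : ℝ) ^ q ∂μ ≤ B.toReal := by
  have hi : Integrable (fun ω => (f ω : ℝ) ^ q) μ := by
    refine ⟨(hfm.coe_nnreal_real.pow_const q).aestronglyMeasurable, ?_⟩
    rw [hasFiniteIntegral_iff_ofReal (ae_of_all _ fun ω => by positivity)]
    refine lt_of_le_of_lt (lintegral_mono fun ω => ?_) (h.trans_lt hB.lt_top)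
    rw [← ENNReal.ofReal_rpow_of_nonneg (f ω).coe_nonneg hq, ENNReal.ofReal_coe_nnreal]
  refine ⟨hi, ?_⟩
  rw [lintegral_coe_rpow_eq_ofReal hq hi] at h
  exact (ENNReal.ofReal_le_iff_le_toReal hB).1 h

theorem integrable_coe_rpow_of_le [IsProbabilityMeasure μ] (hfm : AEMeasurable f μ) {p : ℝ}
    (hq : 0 < q) (hqp : q ≤ p) (hf : Integrable (fun ω => (f ω : ℝ) ^ p) μ) :
    Integrable (fun ω => (f ω : ℝ) ^ q) μ := by
  refine Integrable.mono' ((integrable_const (1 : ℝ)).add hf)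
    (hfm.coe_nnreal_real.pow_const q).aestronglyMeasurable (ae_of_all _ fun ω => ?_)
  have h0 : (0 : ℝ) ≤ f ω := (f ω).coe_nonneg
  rw [Real.norm_of_nonneg (by positivity)]
  simp only [Pi.add_apply]
  rcases le_total (f ω : ℝ) 1 with h | h
  · have := Real.rpow_le_one h0 h hq.le
    have : 0 ≤ (f ω : ℝ) ^ p := by positivity
    linarith
  · have := Real.rpow_le_rpow_of_exponent_le h hqp
    linarith

theorem integrable_coe_of_rpow [IsProbabilityMeasure μ] (hfm : AEMeasurable f μ) {p : ℝ}
    (hp : 1 ≤ p) (hf : Integrable (fun ω => (f ω : ℝ) ^ p) μ) :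
    Integrable (fun ω => (f ω : ℝ)) μ := by
  simpa using integrable_coe_rpow_of_le hfm one_pos hp hf

end NNRealMoments

/-! ### The tree as a smoothing recursion -/

namespace WeightedBranching

variable {Ω : Type*} [MeasurableSpace Ω] {μ : Measure Ω} [IsProbabilityMeasure μ]
  {N₀ : Ω → ℕ} {Q₀ C₀ : Ω → ℝ≥0} {N : List ℕ → Ω → ℕ} {Q C : List ℕ → Ω → ℝ≥0}

/-- The factor of the recursion is `C [0]`, not `C []`, which enters no weight. For the tail, `C
[0]` is independent of the partial weight of the subtree at the child 0, whose law is that of the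
partial weight of the whole tree. -/
theorem IsInput.smoothingRecursion (h : IsInput μ N₀ Q₀ C₀ N Q C)
    (hfin : ∀ n, ∫⁻ ω, (branch N Q C n 0 ω : ℝ≥0∞) ∂μ ≠ ∞) :
    SmoothingRecursion μ (N []) (fun ω => (Q [] ω : ℝ)) (fun ω => (C [0] ω : ℝ))
      (fun n ω => (partialWeight N Q C n ω : ℝ)) (fun n i ω => (branch N Q C n i ω : ℝ)) where
  measurable_N := h.measurable_N []
  measurable_C := (h.measurable_C [0]).coe_nnreal_real
  measurable_R n := (h.measurable_partialWeight n).coe_nnreal_real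
  Q_nonneg ω := (Q [] ω).coe_nonneg
  C_nonneg ω := (C [0] ω).coe_nonneg
  R_zero ω := by simp [partialWeight]
  R_succ n ω := by
    rw [partialWeight_succ_eq]
    push_cast
    rfl
  iid n :=
    { measurable := fun i => (h.measurable_branch n i).coe_nnreal_real
      nonneg := fun i ω => (branch N Q C n i ω).coe_nonneg
      indep := (h.iIndepFun_branch n).comp (fun _ x => (x : ℝ)) fun _ => measurable_coe_nnreal_real
      ident := fun i => (h.identDistrib_branch n i).comp measurable_coe_nnreal_real
      integrable := by
        have := (integrable_coe_rpow_of_lintegral_le (μ := μ) (h.measurable_branch n 0) zero_le_one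
          (hfin n)
          (by simp)).1
        simpa using this }
  indep n := (h.indepFun_N_branch n).comp measurable_id
    (ψ := fun (f : ℕ → ℝ≥0) i => (f i : ℝ))
    (measurable_pi_lambda _ fun i => (measurable_pi_apply i).coe_nnreal_real)
  tail n x := by
    have hB : MeasurableSet {z : ℝ≥0 × ℝ≥0 | x < (z.1 : ℝ) * z.2} :=
      measurableSet_lt measurable_const
        (measurable_fst.coe_nnreal_real.mul measurable_snd.coe_nnreal_real)
    have h1 := ((h.shift 0).indepFun_C_partialWeight n).measureReal_eq_integral
      (h.measurable_C [0]) ((h.shift 0).measurable_partialWeight n) hB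
    simp only [Set.mem_ofPred_eq] at h1
    simp only [branch, NNReal.coe_mul]
    rw [h1]
    refine integral_congr_ae (ae_of_all _ fun ω => ?_)
    exact congrArg ENNReal.toReal ((h.identDistrib_partialWeight n 0).measure_mem_eq
      (s := {r : ℝ≥0 | x < (C [0] ω : ℝ) * r}) (measurableSet_lt measurable_const
        (measurable_coe_nnreal_real.const_mul _)))

/-- The expected total weight of the first `n` generations. -/
theorem IsInput.lintegral_partialWeight (h : IsInput μ N₀ Q₀ C₀ N Q C) {q ρ : ℝ} (hq : 0 ≤ q)
    (hρ : 0 ≤ ρ) (hQ : ∫⁻ ω, (Q₀ ω : ℝ≥0∞) ∂μ = ENNReal.ofReal q)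
    (hNC : (∫⁻ ω, (N₀ ω : ℝ≥0∞) ∂μ) * ∫⁻ ω, (C₀ ω : ℝ≥0∞) ∂μ = ENNReal.ofReal ρ) (n : ℕ) :
    ∫⁻ ω, (partialWeight N Q C n ω : ℝ≥0∞) ∂μ =
      ENNReal.ofReal (q * ∑ k ∈ Finset.range n, ρ ^ k) := by
  induction n with
  | zero => simp [partialWeight]
  | succ n ih =>
    have h0 : 0 ≤ ∑ k ∈ Finset.range n, ρ ^ k := Finset.sum_nonneg fun k _ => by positivity
    rw [h.lintegral_partialWeight_succ, ih, hNC, hQ, ← ENNReal.ofReal_mul hρ,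
      ← ENNReal.ofReal_add hq (by positivity), geom_sum_succ]
    congr 1
    ring

theorem measureReal_lt_partialWeight_le {x : ℝ} (hx : 0 ≤ x) (n : ℕ) :
    μ.real {ω | x < partialWeight N Q C n ω} ≤ μ.real {ω | ENNReal.ofReal x < R N Q C ω} :=
  measureReal_mono fun ω hω => (ofReal_lt_R_iff hx ω).2 ⟨n, hω⟩

/-- The events increase to {R > x}, so continuity from below carries a bound uniform in n over to
`R`. -/
theorem measureReal_lt_R_le {x b : ℝ} (hx : 0 ≤ x)
    (hb : ∀ n, μ.real {ω | x < partialWeight N Q C n ω} ≤ b) :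
    μ.real {ω | ENNReal.ofReal x < R N Q C ω} ≤ b := by
  have e : {ω | ENNReal.ofReal x < R N Q C ω} = ⋃ n, {ω | x < (partialWeight N Q C n ω : ℝ)} := by
    ext ω
    simp only [Set.mem_ofPred_eq, Set.mem_iUnion]
    exact ofReal_lt_R_iff hx ω
  have hmono : Monotone fun n => {ω | x < (partialWeight N Q C n ω : ℝ)} :=
    fun m n hmn ω (hω : x < _) => hω.trans_le (NNReal.coe_le_coe.2 (partialWeight_mono ω hmn))
  have := (ENNReal.tendsto_toReal (measure_ne_top μ _)).comp (tendsto_measure_iUnion_atTop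
    (μ := μ) hmono)
  rw [e]
  exact le_of_tendsto' this hb

end WeightedBranching

/-! ### From the hypotheses to the limit -/

theorem SlowlyVarying.regVarTail {L G : ℝ → ℝ} (hL : SlowlyVarying L) {α : ℝ} (hG : Antitone G)
    (hG1 : ∀ x, G x ≤ 1) (h : ∀ x, 0 < x → G x = x ^ (-α) * L x) : RegVarTail α G where
  anti := hG
  pos x := by
    -- The representation by `L` holds only on (0, ∞); elsewhere positivity follows from
    -- monotonicity.
    have hx : 0 < max x 1 := one_pos.trans_le (le_max_right _ _)
    refine lt_of_lt_of_le ?_ (hG (le_max_left x 1))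
    rw [h _ hx]
    exact mul_pos (Real.rpow_pos_of_pos hx _) (hL.1 _ hx.le)
  le_one := hG1
  tendsto_ratio t ht := by
    have h1 : Tendsto (fun x => t ^ (-α) * (L (t * x) / L x)) atTop (𝓝 (t ^ (-α) * 1)) :=
      (hL.2 t ht).const_mul _
    rw [mul_one] at h1
    refine h1.congr' ?_
    filter_upwards [eventually_gt_atTop 0] with x hx
    have hxα : x ^ (-α) ≠ 0 := (Real.rpow_pos_of_pos hx _).ne'
    rw [h _ hx, h _ (mul_pos ht hx), Real.mul_rpow ht.le hx.le]
    have := (hL.1 x hx.le).ne'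
    field_simp

/-- Interpolation between moments of a nonnegative random variable. -/
theorem integral_rpow_le_of_convex {Ω : Type*} [MeasurableSpace Ω] {μ : Measure Ω} {f : Ω → ℝ}
    (hf0 : ∀ ω, 0 ≤ f ω) {a β w : ℝ} (ha : 0 < a) (hw0 : 0 ≤ w) (hw1 : w ≤ 1)
    (hβ : β = w + (1 - w) * a) (h1 : Integrable f μ) (h2 : Integrable (fun ω => f ω ^ a) μ) :
    ∫ ω, f ω ^ β ∂μ ≤ w * ∫ ω, f ω ∂μ + (1 - w) * ∫ ω, f ω ^ a ∂μ := by
  rw [← integral_const_mul, ← integral_const_mul,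
    ← integral_add (h1.const_mul _) (h2.const_mul _)]
  refine integral_mono_of_nonneg (ae_of_all _ fun ω => Real.rpow_nonneg (hf0 ω) _)
    ((h1.const_mul _).add (h2.const_mul _)) (ae_of_all _ fun ω => ?_)
  have h3 := Real.geom_mean_le_arith_mean2_weighted hw0 (sub_nonneg.2 hw1) (hf0 ω)
    (Real.rpow_nonneg (hf0 ω) a) (by ring)
  rw [← Real.rpow_mul (hf0 ω), ← Real.rpow_add_of_nonneg (hf0 ω) hw0
    (mul_nonneg ha.le (sub_nonneg.2 hw1))] at h3
  simp only
  rw [hβ, mul_comm (1 - w) a]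
  exact h3

theorem theorem4 {Ω : Type*} [MeasurableSpace Ω] (μ : Measure Ω) [IsProbabilityMeasure μ]
    (N₀ : Ω → ℕ) (Q₀ C₀ : Ω → ℝ≥0)
    (N : List ℕ → Ω → ℕ) (Q C : List ℕ → Ω → ℝ≥0)
    (hinput : WeightedBranching.IsInput μ N₀ Q₀ C₀ N Q C)
    (hQ₀ : 0 < μ {ω | 0 < Q₀ ω})
    (α : ℝ) (hα : 1 < α)
    (L : ℝ → ℝ) (hL : SlowlyVarying L)
    (hN₀ : ∀ x : ℝ, 0 < x → μ.real {ω | x < (N₀ ω : ℝ)} = x ^ (-α) * L x)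
    (ρ ρα : ℝ)
    (hρ : ρ = (∫ ω, (N₀ ω : ℝ) ∂μ) * ∫ ω, (C₀ ω : ℝ) ∂μ)
    (hρα : ρα = (∫ ω, (N₀ ω : ℝ) ∂μ) * ∫ ω, (C₀ ω : ℝ) ^ α ∂μ)
    (hlt : max ρ ρα < 1)
    (ε : ℝ) (hε : 0 < ε)
    (hC : Integrable (fun ω => (C₀ ω : ℝ) ^ (α + ε)) μ)
    (hQ : Integrable (fun ω => (Q₀ ω : ℝ) ^ (α + ε)) μ) :
    Tendsto
      (fun x : ℝ => μ.real {ω | ENNReal.ofReal x < WeightedBranching.R N Q C ω} /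
        μ.real {ω | x < (N₀ ω : ℝ)})
      atTop
      (𝓝 (((∫ ω, (C₀ ω : ℝ) ∂μ) * ∫ ω, (Q₀ ω : ℝ) ∂μ) ^ α / ((1 - ρ) ^ α * (1 - ρα)))) ∧
    (0 < μ {ω | 0 < C₀ ω} →
      Asymptotics.IsEquivalent atTop
        (fun x : ℝ => μ.real {ω | ENNReal.ofReal x < WeightedBranching.R N Q C ω})
        (fun x : ℝ =>
          ((∫ ω, (C₀ ω : ℝ) ∂μ) * ∫ ω, (Q₀ ω : ℝ) ∂μ) ^ α / ((1 - ρ) ^ α * (1 - ρα)) *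
            μ.real {ω | x < (N₀ ω : ℝ)})) := by
  have hN₀m : AEMeasurable N₀ μ := (hinput.identDistrib_N []).aemeasurable_snd
  have hQ₀m : AEMeasurable Q₀ μ := (hinput.identDistrib_Q []).aemeasurable_snd
  have hC₀m : AEMeasurable C₀ μ := (hinput.identDistrib_C []).aemeasurable_snd
  have hα0 : 0 < α := by linarith
  have hp : α < α + ε := by linarith
  set G : ℝ → ℝ := fun x => μ.real {ω | x < (N₀ ω : ℝ)} with hGdef
  have hG : RegVarTail α G := hL.regVarTail
    (fun x y hxy => measureReal_mono fun ω (hω : y < _) => hxy.trans_lt hω)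
    (fun x => measureReal_le_one) hN₀
  have hNG : ∀ x, 0 < x → μ.real {ω | x < (N [] ω : ℝ)} = G x := fun x _ =>
    congrArg ENNReal.toReal ((hinput.identDistrib_N []).measure_mem_eq
      (s := {k : ℕ | x < (k : ℝ)}) MeasurableSet.of_discrete)
  have hNm : Measurable fun ω => (N [] ω : ℝ) :=
    measurable_from_nat.comp (hinput.measurable_N [])
  -- moments of the generic variables
  have hNident : ∀ q : ℝ, IdentDistrib (fun ω => (N [] ω : ℝ) ^ q) (fun ω => (N₀ ω : ℝ) ^ q) μ μ :=
    fun q => (hinput.identDistrib_N []).comp (u := fun k : ℕ => (k : ℝ) ^ q) measurable_from_nat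
  have hCident : ∀ q : ℝ, IdentDistrib (fun ω => (C [0] ω : ℝ) ^ q)
      (fun ω => (C₀ ω : ℝ) ^ q) μ μ := fun q =>
    (hinput.identDistrib_C [0]).comp (u := fun x : ℝ≥0 => (x : ℝ) ^ q)
      (measurable_coe_nnreal_real.pow_const q)
  have hQident : ∀ q : ℝ, IdentDistrib (fun ω => (Q [] ω : ℝ) ^ q)
      (fun ω => (Q₀ ω : ℝ) ^ q) μ μ := fun q =>
    (hinput.identDistrib_Q []).comp (u := fun x : ℝ≥0 => (x : ℝ) ^ q)
      (measurable_coe_nnreal_real.pow_const q)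
  have hNβ : ∀ β, 0 < β → β < α → Integrable (fun ω => (N₀ ω : ℝ) ^ β) μ := fun β h0 h1 =>
    (hNident β).integrable_iff.1 (hG.integrable_rpow hNm (fun ω => by positivity) hNG h0 h1)
  have hN1 : Integrable (fun ω => (N₀ ω : ℝ)) μ := by simpa using hNβ 1 one_pos hα
  have hNi : Integrable (fun ω => (N [] ω : ℝ)) μ := by
    have := (hNident 1).integrable_iff.2 (hNβ 1 one_pos hα)
    simpa using this
  have hC1 : Integrable (fun ω => (C₀ ω : ℝ)) μ := integrable_coe_of_rpow hC₀m (by linarith) hC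
  have hCα : Integrable (fun ω => (C₀ ω : ℝ) ^ α) μ :=
    integrable_coe_rpow_of_le hC₀m hα0 hp.le hC
  have hQ1 : Integrable (fun ω => (Q₀ ω : ℝ)) μ := integrable_coe_of_rpow hQ₀m (by linarith) hQ
  set ν := ∫ ω, (N₀ ω : ℝ) ∂μ with hν
  set c := ∫ ω, (C₀ ω : ℝ) ∂μ with hc
  set cα := ∫ ω, (C₀ ω : ℝ) ^ α ∂μ with hcα
  set q := ∫ ω, (Q₀ ω : ℝ) ∂μ with hq
  have hν0 : 0 ≤ ν := integral_nonneg fun ω => by positivity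
  have hc0 : 0 ≤ c := integral_nonneg fun ω => by positivity
  have hcα0 : 0 ≤ cα := integral_nonneg fun ω => by positivity
  have hq0 : 0 ≤ q := integral_nonneg fun ω => by positivity
  have hρ1 : ρ < 1 := (le_max_left _ _).trans_lt hlt
  have hρα1 : ρα < 1 := (le_max_right _ _).trans_lt hlt
  have hρ0 : 0 ≤ ρ := by rw [hρ]; positivity
  have hνN : ∫ ω, (N [] ω : ℝ) ∂μ = ν := by
    simpa using (hNident 1).integral_eq
  have hcC : ∫ ω, (C [0] ω : ℝ) ^ α ∂μ = cα := (hCident α).integral_eq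
  have hν_pos : 0 < ν := by
    rw [← hνN, integral_pos_iff_support_of_nonneg (fun ω => by positivity) hNi]
    -- The representation of the tail by the positive function `L` rules out a vanishing mean.
    have h1 : 0 < μ.real {ω | (1 : ℝ) < (N [] ω : ℝ)} := by rw [hNG 1 one_pos]; exact hG.pos 1
    refine (ENNReal.toReal_pos_iff.1 h1).1.trans_le (measure_mono fun ω hω => ?_)
    rw [Set.mem_ofPred_eq] at hω
    rw [Function.mem_support]
    linarith
  have lN : ∫⁻ ω, (N₀ ω : ℝ≥0∞) ∂μ = ENNReal.ofReal ν := by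
    have := lintegral_coe_eq_ofReal (f := fun ω => (N₀ ω : ℝ≥0)) (by simpa using hN1)
    simpa using this
  have lC : ∫⁻ ω, (C₀ ω : ℝ≥0∞) ∂μ = ENNReal.ofReal c := lintegral_coe_eq_ofReal hC1
  have lQ : ∫⁻ ω, (Q₀ ω : ℝ≥0∞) ∂μ = ENNReal.ofReal q := lintegral_coe_eq_ofReal hQ1
  -- means of the iterates
  have lNC : (∫⁻ ω, (N₀ ω : ℝ≥0∞) ∂μ) * ∫⁻ ω, (C₀ ω : ℝ≥0∞) ∂μ = ENNReal.ofReal ρ := by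
    rw [lN, lC, ← ENNReal.ofReal_mul hν0, hρ]
  -- `r n` is the mean of one branch: the geometric partial sum comes from E[R_{n+1}] = E[Q] +
  -- ρE[R_n], and it increases to `m₀`.
  set r : ℕ → ℝ := fun n => c * (q * ∑ k ∈ Finset.range n, ρ ^ k) with hr
  set m₀ := c * q / (1 - ρ) with hm₀
  have hr0 : ∀ n, 0 ≤ r n := fun n => by
    have : 0 ≤ ∑ k ∈ Finset.range n, ρ ^ k := Finset.sum_nonneg fun k _ => by positivity
    positivity
  have lX : ∀ n, ∫⁻ ω, (WeightedBranching.branch N Q C n 0 ω : ℝ≥0∞) ∂μ =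
      ENNReal.ofReal (r n) := fun n => by
    rw [hinput.lintegral_branch, hinput.lintegral_partialWeight hq0 hρ0 lQ lNC, lC,
      ← ENNReal.ofReal_mul hc0]
  have hs := hinput.smoothingRecursion fun n => by rw [lX]; exact ENNReal.ofReal_ne_top
  have hXmean : ∀ n, ∫ ω, (WeightedBranching.branch N Q C n 0 ω : ℝ) ∂μ = r n := fun n => by
    have := lintegral_coe_eq_ofReal (hs.iid n).integrable
    rw [lX, ENNReal.ofReal_eq_ofReal_iff (hr0 n) (integral_nonneg fun ω => by positivity)] at this
    exact this.symm
  have hrlim : Tendsto r atTop (𝓝 m₀) := by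
    have := (((hasSum_geometric_of_lt_one hρ0 hρ1).tendsto_sum_nat).const_mul q).const_mul c
    rwa [← mul_assoc, ← div_eq_mul_inv] at this
  have hrm : ∀ n, r n ≤ m₀ := fun n => by
    have := (summable_geometric_of_lt_one hρ0 hρ1).sum_le_tsum (Finset.range n)
      fun k _ => by positivity
    rw [tsum_geometric_of_lt_one hρ0 hρ1] at this
    rw [hm₀, div_eq_mul_inv, mul_assoc]
    exact mul_le_mul_of_nonneg_left (mul_le_mul_of_nonneg_left this hq0) hc0
  -- a moment of order larger than one
  obtain ⟨β, hβ1, hβ2⟩ := exists_between (lt_min one_lt_two hα)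
  have hβ2' : β ≤ 2 := hβ2.le.trans (min_le_left _ _)
  have hβα : β < α := hβ2.trans_le (min_le_right _ _)
  have hβ0 : 0 < β := by linarith
  have hCβ : Integrable (fun ω => (C₀ ω : ℝ) ^ β) μ :=
    integrable_coe_rpow_of_le hC₀m hβ0 (by linarith) hC
  -- β is a convex combination of 1 and α with weight w on 1, so E[N]E[C^β] is at most wρ +
  -- (1-w)ρ_α.
  have hρβ : ν * ∫ ω, (C₀ ω : ℝ) ^ β ∂μ < 1 := by
    have hα1 : 0 < α - 1 := by linarith
    set w := (α - β) / (α - 1) with hw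
    have hw0 : 0 ≤ w := div_nonneg (by linarith) hα1.le
    have hw1 : w ≤ 1 := by rw [hw, div_le_one hα1]; linarith
    have := integral_rpow_le_of_convex (fun ω => (C₀ ω).coe_nonneg) hα0 hw0 hw1
      (β := β) (by rw [hw]; field_simp; ring) hC1 hCα
    calc ν * ∫ ω, (C₀ ω : ℝ) ^ β ∂μ ≤ ν * (w * c + (1 - w) * cα) :=
          mul_le_mul_of_nonneg_left this hν0
      _ = w * ρ + (1 - w) * ρα := by rw [hρ, hρα]; ring
      _ ≤ w * max ρ ρα + (1 - w) * max ρ ρα := by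
          have := sub_nonneg.2 hw1
          gcongr
          · exact le_max_left _ _
          · exact le_max_right _ _
      _ = max ρ ρα := by ring
      _ < 1 := hlt
  obtain ⟨B, hB, hBR⟩ := hinput.exists_lintegral_partialWeight_rpow_le hβ1 hβ2'
    (D := ENNReal.ofReal m₀) ENNReal.ofReal_ne_top
    (fun n => by rw [lX]; exact ENNReal.ofReal_le_ofReal (hrm n))
    (by
      have := lintegral_coe_rpow_eq_ofReal (f := fun ω => (N₀ ω : ℝ≥0)) (μ := μ) hβ0.le
        (by simpa using hNβ β hβ0 hβα)
      simp only [ENNReal.coe_natCast] at this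
      rw [this]
      exact ENNReal.ofReal_ne_top)
    (by
      rw [lintegral_coe_rpow_eq_ofReal hβ0.le
        (integrable_coe_rpow_of_le hQ₀m hβ0 (by linarith) hQ)]
      exact ENNReal.ofReal_ne_top)
    (by
      rw [lN, lintegral_coe_rpow_eq_ofReal hβ0.le hCβ, ← ENNReal.ofReal_mul hν0]
      exact ENNReal.ofReal_lt_one.2 hρβ)
  have hXβ := fun n => integrable_coe_rpow_of_lintegral_le (μ := μ) (hinput.measurable_branch n 0)
    hβ0.le (B := (∫⁻ ω, (C₀ ω : ℝ≥0∞) ^ β ∂μ) * B)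
    (ENNReal.mul_ne_top (by
      rw [lintegral_coe_rpow_eq_ofReal hβ0.le hCβ]; exact ENNReal.ofReal_ne_top) hB)
    (by rw [hinput.lintegral_branch_rpow n β hβ0.le]; gcongr; exact hBR n)
  -- the two asymptotic bounds
  have hρα' : ρα = (∫ ω, (N [] ω : ℝ) ∂μ) * ∫ ω, (C [0] ω : ℝ) ^ α ∂μ := by rw [hνN, hcC, hρα]
  have hCp := (hCident (α + ε)).integrable_iff.2 hC
  have hQp := (hQident (α + ε)).integrable_iff.2 hQ
  have hlimit : (c * q) ^ α / ((1 - ρ) ^ α * (1 - ρα)) = m₀ ^ α / (1 - ρα) := by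
    rw [hm₀, Real.div_rpow (by positivity) (by linarith), div_div]
  have hmain : Tendsto (fun x : ℝ =>
      μ.real {ω | ENNReal.ofReal x < WeightedBranching.R N Q C ω} / G x) atTop
      (𝓝 ((c * q) ^ α / ((1 - ρ) ^ α * (1 - ρα)))) := by
    rw [hlimit]
    -- Below the limit a single iterate `partialWeight n` gives the bound; above it, the bound holds
    -- for all iterates at once and passes to `R`.
    refine tendsto_order.2 ⟨fun a ha => ?_, fun a ha => ?_⟩
    · obtain ⟨h, hah, hh⟩ := exists_between ha
      obtain ⟨n, hn⟩ := hs.exists_eventually_le hG hα0 hp hCp hNi (by rwa [hνN]) hNG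
        (by simp_rw [hXmean]; exact hrlim) hρα' hρα1 hh
      filter_upwards [hn, eventually_ge_atTop 0] with x hx hx0
      rw [lt_div_iff₀ (hG.pos x)]
      calc a * G x < h * G x := mul_lt_mul_of_pos_right hah (hG.pos x)
        _ ≤ _ := hx
        _ ≤ _ := WeightedBranching.measureReal_lt_partialWeight_le hx0 n
    · obtain ⟨h, hh, hha⟩ := exists_between ha
      have hn := hs.eventually_forall_le hG hα0 hp hCp hQp hNi hNG hβ1 hβ2'
        (fun n => (hXmean n).trans_le (hrm n)) (fun n => (hXβ n).1) (fun n => (hXβ n).2)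
        hρα' hρα1 hh
      filter_upwards [hn, eventually_ge_atTop 0] with x hx hx0
      rw [div_lt_iff₀ (hG.pos x)]
      exact (WeightedBranching.measureReal_lt_R_le hx0 hx).trans_lt
        (mul_lt_mul_of_pos_right hha (hG.pos x))
  refine ⟨hmain, fun hC₀ => ?_⟩
  have hc_pos : 0 < c := by
    rw [hc, integral_pos_iff_support_of_nonneg (fun ω => by positivity) hC1]
    refine hC₀.trans_le (measure_mono fun ω hω => ?_)
    rw [Set.mem_ofPred_eq] at hω
    rw [Function.mem_support]
    exact_mod_cast hω.ne'
  have hq_pos : 0 < q := by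
    rw [hq, integral_pos_iff_support_of_nonneg (fun ω => by positivity) hQ1]
    refine hQ₀.trans_le (measure_mono fun ω hω => ?_)
    rw [Set.mem_ofPred_eq] at hω
    rw [Function.mem_support]
    exact_mod_cast hω.ne'
  have hlpos : 0 < (c * q) ^ α / ((1 - ρ) ^ α * (1 - ρα)) := by
    have h1 : 0 < 1 - ρ := by linarith
    have h2 : 0 < 1 - ρα := by linarith
    positivity
  refine Asymptotics.isEquivalent_of_tendsto_one ?_
  have := hmain.div_const ((c * q) ^ α / ((1 - ρ) ^ α * (1 - ρα)))
  rw [div_self hlpos.ne'] at this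
  refine this.congr fun x => ?_
  rw [div_div, mul_comm (G x)]
  rfl
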